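/- Let $X$ be the graph with vertex set $\mathbb{Z}^2$ in which two points are joined by an edge iff their $\ell_1$-distance is $1$. For a finite $A\subset\mathbb{Z}^2$ let $\partial A$ be its vertex boundary, the set of points outside $A$ adjacent to a point of $A$. A nonempty finite set $A$ is *minimal* if $|\partial A|\le|\partial B|$ for every $B\subset\mathbb{Z}^2$ with $|B|=|A|$. Two sets are *congruent* if an automorphism of $X$ maps one onto the other. The *graph of minimal sets* $\mathcal{G}$ has as vertices the congruence classes of minimal sets; two classes are adjacent iff they have representatives $A,B$ with $|A\,\triangle\,B|=1$. The *height* of a connected component of $\mathcal{G}$ is the maximal length (number of terms) of a strictly nested sequence of minimal sets whose classes lie in it. A *box* is a nonempty set $B(a,b,c,d)=\{(x,y)\in\mathbb{Z}^2 : a\le y-x\le b,\ c\le y+x\le d\}$ with $a,b,c,d\in\mathbb{Z}$; its *modulus* is the unordered pair $\{b-a,d-c\}$, where among all parameters describing the box $a,c$ are chosen maximal and $b,d$ minimal. The *enclosing box* $\mathrm{enc}(A)$ of a nonempty finite set $A$ is the smallest box containing $A$. The *excess* of $A$ is $\mathrm{Exc}(A)=\max\{|A|-|B| : B \text{ minimal},\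 |\partial B|=|\partial A|\}$. A *standard line* is a set $\{(x,y)\in\mathbb{Z}^2 : y-x=w\}$ or $\{(x,y)\in\mathbb{Z}^2 : y+x=w\}$ with $w\in\mathbb{Z}$. The *life expectancy* of a minimal set $A$ is the maximal $n$ (possibly $\infty$) for which there are minimal sets $A=A_0\subset A_1\subset\dots\subset A_n$ with $|A_i|=|A|+i$; a minimal set is *dead* if its life expectancy is $0$. **Theorem.** (1) Let $B$ be a box such that $\mathrm{Exc}(B)=d\ge 0$; its modulus $\{\alpha,\beta\}$ satisfies $\alpha,\beta\ge 2$; every standard line $L$ has $B\cap L=\emptyset$ or $|B\cap L|\ge d+2$; and $B$ is dead. Let $\mathcal{C}$ be the component of $\mathcal{G}$ containing the class of $B$. Then every set $A$ representing a vertex of $\mathcal{C}$ satisfies $|B|-d\le|A|\le|B|$, and $\mathrm{enc}(A)$ is congruent to $B$; for every integer $k$ with $|B|-d\le k\le|B|$ some vertex of $\mathcal{C}$ is represented by a set of size $k$; and $\mathcal{C}$ is finite and has height exactly $d+1$. (2) $\mathcal{G}$ has finite components of arbitrarily large height: for every $n\in\mathbb{N}$ there is a finite component of $\mathcal{G}$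 whose height is finite and at least $n$. (3) $\mathcal{G}$ has infinitely many isolated vertices. -/

import Mathlib

open scoped symmDiff

/-! ### The lattice graph, vertex boundaries and minimal sets -/

/-- The graph on `ℤ²` joining points at `ℓ₁`-distance one. -/
def latticeGraph : SimpleGraph (ℤ × ℤ) where
  Adj u v := |u.1 - v.1| + |u.2 - v.2| = 1
  symm := ⟨fun u v h => by rw [abs_sub_comm v.1, abs_sub_comm v.2]; exact h⟩
  loopless := ⟨fun u h => by simp at h⟩

/-- The vertex boundary of a set of vertices of a graph. -/
def vertexBoundary {V : Type*} (G : SimpleGraph V) (A : Set V) : Set V :=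
  {u | u ∉ A ∧ ∃ v ∈ A, G.Adj u v}

/-- A finite set of lattice points has a finite vertex boundary, so `Set.ncard` below counts it. -/
theorem vertexBoundary_finite (A : Finset (ℤ × ℤ)) :
    (vertexBoundary latticeGraph (A : Set (ℤ × ℤ))).Finite := by
  refine Set.Finite.subset (Set.Finite.biUnion A.finite_toSet
    (fun v _ => Set.finite_Icc (v - (1, 1)) (v + (1, 1)))) ?_
  rintro u ⟨-, v, hv, huv⟩
  have h : |u.1 - v.1| + |u.2 - v.2| = 1 := huv
  have h1 := abs_nonneg (u.1 - v.1)
  have h2 := abs_nonneg (u.2 - v.2)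
  have h3 : |u.1 - v.1| ≤ 1 := by omega
  have h4 : |u.2 - v.2| ≤ 1 := by omega
  rw [abs_le] at h3 h4
  simp only [Set.mem_iUnion]
  refine ⟨v, hv, ?_⟩
  rw [Set.mem_Icc, Prod.le_def, Prod.le_def]
  simp only [Prod.fst_sub, Prod.snd_sub, Prod.fst_add, Prod.snd_add]
  omega

/-- The size of the vertex boundary of a finite set of lattice points. -/
noncomputable def boundarySize (A : Finset (ℤ × ℤ)) : ℕ :=
  (vertexBoundary latticeGraph (A : Set (ℤ × ℤ))).ncard

/-- A minimal set: a nonempty finite set of lattice points whose vertex boundary is smallest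
among all sets with the same number of points. -/
def IsMinimal (A : Finset (ℤ × ℤ)) : Prop :=
  A.Nonempty ∧ ∀ B : Finset (ℤ × ℤ), B.card = A.card → boundarySize A ≤ boundarySize B

/-- Two sets are congruent if an automorphism of the lattice graph takes one to the other. -/
def LatticeCongruent (A B : Finset (ℤ × ℤ)) : Prop :=
  ∃ φ : latticeGraph ≃g latticeGraph, φ '' (A : Set (ℤ × ℤ)) = (B : Set (ℤ × ℤ))

theorem LatticeCongruent.card_eq {A B : Finset (ℤ × ℤ)} (h : LatticeCongruent A B) : A.card = B.card := by
  obtain ⟨φ, h⟩ := h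
  have := Set.ncard_image_of_injective (A : Set (ℤ × ℤ)) φ.injective
  rw [h, Set.ncard_coe_finset, Set.ncard_coe_finset] at this
  exact this.symm

/-! ### The graph of minimal sets -/

/-- Congruence as an equivalence relation on the minimal sets. -/
def congruenceSetoid : Setoid {A : Finset (ℤ × ℤ) // IsMinimal A} where
  r A B := LatticeCongruent A.1 B.1
  iseqv :=
    { refl := fun A => ⟨SimpleGraph.Iso.refl, by ext x; simp⟩
      symm := by
        rintro A B ⟨φ, h⟩
        refine ⟨φ.symm, ?_⟩
        rw [← h, Set.image_image]
        simp
      trans := by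
        rintro A B C ⟨φ, h⟩ ⟨ψ, h'⟩
        refine ⟨φ.trans ψ, ?_⟩
        rw [← h', ← h, Set.image_image]
        rfl }

/-- Congruence classes of minimal sets. -/
def MinimalClass : Type := Quotient congruenceSetoid

/-- The congruence class of a minimal set. -/
def minimalClass (A : Finset (ℤ × ℤ)) (hA : IsMinimal A) : MinimalClass :=
  Quotient.mk congruenceSetoid ⟨A, hA⟩

/-- `A` is a minimal set representing the class `v`. -/
def Represents (A : Finset (ℤ × ℤ)) (v : MinimalClass) : Prop :=
  ∃ hA : IsMinimal A, minimalClass A hA = v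

/-- The graph of minimal sets: two classes are joined by an edge if they have representatives
whose symmetric difference has exactly one element. -/
def minimalSetGraph : SimpleGraph MinimalClass where
  Adj v w := ∃ A B : Finset (ℤ × ℤ), Represents A v ∧ Represents B w ∧ (A ∆ B).card = 1
  symm := ⟨by
    rintro v w ⟨A, B, hA, hB, h⟩
    exact ⟨B, A, hB, hA, by rw [symmDiff_comm]; exact h⟩⟩
  loopless := ⟨by
    rintro v ⟨A, B, ⟨hA, rfl⟩, ⟨hB, hAB⟩, h⟩
    have hc : B.card = A.card := LatticeCongruent.card_eq (Quotient.exact hAB)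
    have h1 : (A ∆ B).card = (A \ B).card + (B \ A).card :=
      Finset.card_union_of_disjoint disjoint_sdiff_sdiff
    have h2 := Finset.card_sdiff_add_card_inter A B
    have h3 := Finset.card_sdiff_add_card_inter B A
    rw [Finset.inter_comm] at h3
    omega⟩

/-- The minimal sets whose congruence classes lie in a component of the graph. -/
def setsInComponent (C : minimalSetGraph.ConnectedComponent) : Set (Finset (ℤ × ℤ)) :=
  {A | ∃ v ∈ C.supp, Represents A v}

/-- The height of a component: the maximal length (number of terms) of a strictly nested sequence
of minimal sets in it. -/
noncomputable def componentHeight (C : minimalSetGraph.ConnectedComponent) : ℕ∞ :=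
  (setsInComponent C).chainHeight (· ⊂ ·)

/-! ### Boxes -/

/-- The points between the lines `y - x = a`, `y - x = b`, `y + x = c` and `y + x = d`. -/
def boxRegion (a b c d : ℤ) : Set (ℤ × ℤ) :=
  {p | (a ≤ p.2 - p.1 ∧ p.2 - p.1 ≤ b) ∧ (c ≤ p.2 + p.1 ∧ p.2 + p.1 ≤ d)}

/-- A box is a nonempty set of the form `boxRegion a b c d`. -/
def IsBox (B : Finset (ℤ × ℤ)) : Prop :=
  B.Nonempty ∧ ∃ a b c d : ℤ, (B : Set (ℤ × ℤ)) = boxRegion a b c d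

/-- The modulus of a box is the unordered pair `{b - a, d - c}`, where among all parameters
describing the box `a` and `c` are chosen maximal and `b` and `d` minimal. -/
def HasModulus (B : Finset (ℤ × ℤ)) (m : Sym2 ℤ) : Prop :=
  B.Nonempty ∧ ∃ a b c d : ℤ, (B : Set (ℤ × ℤ)) = boxRegion a b c d ∧
    (∀ a' b' c' d' : ℤ, (B : Set (ℤ × ℤ)) = boxRegion a' b' c' d' →
      a' ≤ a ∧ b ≤ b' ∧ c' ≤ c ∧ d ≤ d') ∧
    m = s(b - a, d - c)

/-- `E` is the enclosing box of `A`, the smallest box containing `A`. -/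
def IsEnclosingBox (A E : Finset (ℤ × ℤ)) : Prop :=
  IsLeast {E' : Finset (ℤ × ℤ) | IsBox E' ∧ A ⊆ E'} E

/-- The lines `y - x = w` and `y + x = w` with `w` an integer. -/
def IsStandardLine (L : Set (ℤ × ℤ)) : Prop :=
  ∃ w : ℤ, L = {p | p.2 - p.1 = w} ∨ L = {p | p.2 + p.1 = w}

/-! ### Excess and dead sets -/

/-- The differences `|A| - |B|`, for `B` minimal with a vertex boundary of the same size as
that of `A`. -/
def excessSet (A : Finset (ℤ × ℤ)) : Set ℤ :=
  {e | ∃ B : Finset (ℤ × ℤ), IsMinimal B ∧ boundarySize A = boundarySize B ∧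
    e = (A.card : ℤ) - (B.card : ℤ)}

/-- The excess of a set, the maximum of `excessSet`. -/
noncomputable def excess (A : Finset (ℤ × ℤ)) : ℤ := sSup (excessSet A)

theorem excess_isGreatest_of_nonempty {A : Finset (ℤ × ℤ)} (hA : (excessSet A).Nonempty) :
    IsGreatest (excessSet A) (excess A) := by
  have hb : BddAbove (excessSet A) := by
    refine ⟨(A.card : ℤ), ?_⟩
    rintro e ⟨B, -, -, rfl⟩
    omega
  exact ⟨Int.csSup_mem hA hb, fun e he => le_csSup hb he⟩

/-- For a minimal set the maximum defining the excess is attained. -/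
theorem IsMinimal.excess_isGreatest {A : Finset (ℤ × ℤ)} (hA : IsMinimal A) :
    IsGreatest (excessSet A) (excess A) :=
  excess_isGreatest_of_nonempty ⟨_, A, hA, rfl, rfl⟩

/-- The life expectancy of `A`: the largest `n` for which there are nested minimal sets
`A = A₀ ⊆ A₁ ⊆ ⋯ ⊆ Aₙ` with `|Aᵢ| = |A| + i`. -/
noncomputable def lifeExpectancy (A : Finset (ℤ × ℤ)) : ℕ∞ :=
  ⨆ (n : ℕ) (_ : ∃ s : Fin (n + 1) → Finset (ℤ × ℤ), s 0 = A ∧ Monotone s ∧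
    ∀ i, IsMinimal (s i) ∧ (s i).card = A.card + (i : ℕ)), (n : ℕ∞)

/-- A dead set is a minimal set of life expectancy zero. -/
def IsDead (A : Finset (ℤ × ℤ)) : Prop :=
  IsMinimal A ∧ lifeExpectancy A = 0

/-! In the diagonal coordinates u = y - x, v = y + x a box is a rectangle. Two facts carry the
proof. First, |∂A| ≥ |u(A)| + |v(A)| + 2 (`card_image_add_card_image_le_boundarySize`), with
equality for boxes having at least two lines in each direction (`boundarySize_box_le`). Second, some
point can always be deleted without enlarging the boundary, so the least boundary is monotone in the
size (`IsMinimal.boundarySize_le`).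

Let B be the box of (1). Every line meeting B has at least d + 2 points of it, so a subset missing
at most d + 1 points has the same projections and boundary at least |∂B|. Walking down through
minimal subsets of B therefore stops at size |B| - d: one point further the boundary would still
equal |∂B|, against the excess. Walking up never leaves B: if A ∪ {x} is minimal and no larger than
B, its boundary is at most |∂B|, so its projections are those of B and x lies in B; and B itself is
dead. Thus every class of the component has a representative inside B missing at most d points
(`below_of_mem_supp`), which gives finiteness, the enclosing boxes and the upper bound on the
height. Conversely, deleting points of B one at a time without enlarging the boundary gives minimal
sets of all sizes down to |B| - d.

For (2) and (3), explicit boxes are certified by the isoperimetric inequality 8|A| ≤ (|∂A| - 2)² +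
4, proved by compression and a parity count. A box with 2a and 2b lines, a + b = s, has (s² - (a -
b)²)/2 points, while (s² - s)/2 points are still possible with a smaller boundary. The excess is
thus (s - (a - b)²)/2 - 1, which can be tuned, and a box that is not the largest of its boundary
size is dead. -/

/-! ### Diagonal coordinates and the boundary as a finset -/

/-- The first diagonal coordinate. -/
def diagU (p : ℤ × ℤ) : ℤ := p.2 - p.1

/-- The second diagonal coordinate. -/
def diagV (p : ℤ × ℤ) : ℤ := p.2 + p.1

theorem diag_ext {p q : ℤ × ℤ} (h : diagU p = diagU q) (h' : diagV p = diagV q) : p = q := by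
  simp only [diagU, diagV] at h h'
  ext <;> omega

theorem latticeGraph_adj_iff (p q : ℤ × ℤ) : latticeGraph.Adj p q ↔
    (diagU p = diagU q + 1 ∨ diagU p = diagU q - 1) ∧
      (diagV p = diagV q + 1 ∨ diagV p = diagV q - 1) := by
  change |p.1 - q.1| + |p.2 - q.2| = 1 ↔ _
  simp only [diagU, diagV]
  rcases abs_cases (p.1 - q.1) with h | h <;> rcases abs_cases (p.2 - q.2) with h' | h' <;> omega

theorem exists_diag_step (p : ℤ × ℤ) {s t : ℤ} (hs : s = 1 ∨ s = -1) (ht : t = 1 ∨ t = -1) :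
    ∃ q, diagU q = diagU p + s ∧ diagV q = diagV p + t := by
  rcases hs with rfl | rfl <;> rcases ht with rfl | rfl
  · exact ⟨(p.1, p.2 + 1), by simp only [diagU, diagV]; omega⟩
  · exact ⟨(p.1 - 1, p.2), by simp only [diagU, diagV]; omega⟩
  · exact ⟨(p.1 + 1, p.2), by simp only [diagU, diagV]; omega⟩
  · exact ⟨(p.1, p.2 - 1), by simp only [diagU, diagV]; omega⟩

/-- The vertex boundary as a finset. -/
noncomputable def boundaryFinset (A : Finset (ℤ × ℤ)) : Finset (ℤ × ℤ) :=
  (vertexBoundary_finite A).toFinset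

theorem mem_boundaryFinset {A : Finset (ℤ × ℤ)} {q : ℤ × ℤ} :
    q ∈ boundaryFinset A ↔ q ∉ A ∧ ∃ a ∈ A, latticeGraph.Adj q a := by
  simp [boundaryFinset, vertexBoundary]

theorem card_boundaryFinset (A : Finset (ℤ × ℤ)) :
    (boundaryFinset A).card = boundarySize A := by
  rw [boundarySize, boundaryFinset, Set.ncard_eq_toFinset_card _ (vertexBoundary_finite A)]

/-! ### A lower bound for the boundary by the sizes of the diagonal projections -/

/-- The point `q` lies on one of the lines `f = w`, `f = w + 1`, is adjacent to a point of `A` on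
the other, and all points of `A` on the two lines lie on the same side of it. -/
def IsExtremalOn (A : Finset (ℤ × ℤ)) (f g : ℤ × ℤ → ℤ) (w : ℤ) (q : ℤ × ℤ) : Prop :=
  (f q = w ∨ f q = w + 1) ∧
    (∃ a ∈ A, f a + f q = 2 * w + 1 ∧ (g a = g q + 1 ∨ g a = g q - 1)) ∧
    ((∀ a ∈ A, f a = w ∨ f a = w + 1 → g a < g q) ∨
      (∀ a ∈ A, f a = w ∨ f a = w + 1 → g q < g a))

theorem IsExtremalOn.notMem {A : Finset (ℤ × ℤ)} {f g : ℤ × ℤ → ℤ} {w : ℤ} {q : ℤ × ℤ}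
    (h : IsExtremalOn A f g w q) : q ∉ A := by
  intro hq
  obtain ⟨h1, -, h2 | h2⟩ := h
  · exact lt_irrefl _ (h2 q hq h1)
  · exact lt_irrefl _ (h2 q hq h1)

theorem exists_two_isExtremalOn (A : Finset (ℤ × ℤ)) (f g : ℤ × ℤ → ℤ)
    (hfg : ∀ (p : ℤ × ℤ) {s t : ℤ}, s = 1 ∨ s = -1 → t = 1 ∨ t = -1 →
      ∃ q, f q = f p + s ∧ g q = g p + t) (w : ℤ) (hw : ∃ a ∈ A, f a = w ∨ f a = w + 1) :
    ∃ q₁ q₂, q₁ ≠ q₂ ∧ IsExtremalOn A f g w q₁ ∧ IsExtremalOn A f g w q₂ := by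
  have hne : (A.filter fun a => f a = w ∨ f a = w + 1).Nonempty := by
    obtain ⟨a, ha, h⟩ := hw
    exact ⟨a, by simp [ha, h]⟩
  obtain ⟨a, ha, hmax⟩ := Finset.exists_max_image _ g hne
  obtain ⟨b, hb, hmin⟩ := Finset.exists_min_image _ g hne
  simp only [Finset.mem_filter, and_imp] at ha hb hmax hmin
  obtain ⟨s, hs, hs'⟩ : ∃ s : ℤ, (s = 1 ∨ s = -1) ∧ f a + (f a + s) = 2 * w + 1 := by
    rcases ha.2 with h | h
    · exact ⟨1, by omega⟩
    · exact ⟨-1, by omega⟩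
  obtain ⟨t, ht, ht'⟩ : ∃ t : ℤ, (t = 1 ∨ t = -1) ∧ f b + (f b + t) = 2 * w + 1 := by
    rcases hb.2 with h | h
    · exact ⟨1, by omega⟩
    · exact ⟨-1, by omega⟩
  obtain ⟨q, hq, hq'⟩ := hfg a hs (Or.inl rfl)
  obtain ⟨r, hr, hr'⟩ := hfg b ht (Or.inr rfl)
  have hab := hmin a ha.1 ha.2
  refine ⟨q, r, fun h => ?_, ⟨by omega, ⟨a, ha.1, by omega, by omega⟩, Or.inl fun c hc h => ?_⟩,
    ⟨by omega, ⟨b, hb.1, by omega, by omega⟩, Or.inr fun c hc h => ?_⟩⟩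
  · rw [h] at hq'
    omega
  · have := hmax c hc h
    omega
  · have := hmin c hc h
    omega

/-- The point of `A` on the line through `q` forces `A` to lie on the same side of `q` for both
pairs. The neighbours `b` and `c` of `q` are then on one line of `g`, on opposite sides of `q` in
the direction `f`, which excludes the `g`-pair containing them; the other `g`-pair would need a
neighbour of `q` on the empty side. -/
theorem isExtremalOn_exclusive {A : Finset (ℤ × ℤ)} {f g : ℤ × ℤ → ℤ} {q : ℤ × ℤ}
    (h₁ : IsExtremalOn A f g (f q - 1) q) (h₂ : IsExtremalOn A f g (f q) q)
    (h₀ : ∃ a ∈ A, f a = f q) :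
    ¬ IsExtremalOn A g f (g q - 1) q ∧ ¬ IsExtremalOn A g f (g q) q := by
  obtain ⟨a, ha, haq⟩ := h₀
  obtain ⟨-, ⟨b, hb, hbq, hbq'⟩, h₁⟩ := h₁
  obtain ⟨-, ⟨c, hc, hcq, hcq'⟩, h₂⟩ := h₂
  constructor
  · rintro ⟨-, ⟨e, he, heq, heq'⟩, h₃⟩
    rcases h₁ with h₁ | h₁ <;> rcases h₂ with h₂ | h₂ <;> rcases h₃ with h₃ | h₃ <;>
    · have := h₁ a ha
      have := h₁ b hb
      have := h₁ e he
      have := h₂ a ha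
      have := h₂ c hc
      have := h₂ e he
      have := h₃ b hb
      have := h₃ c hc
      omega
  · rintro ⟨-, ⟨e, he, heq, heq'⟩, h₃⟩
    rcases h₁ with h₁ | h₁ <;> rcases h₂ with h₂ | h₂ <;> rcases h₃ with h₃ | h₃ <;>
    · have := h₁ a ha
      have := h₁ b hb
      have := h₁ e he
      have := h₂ a ha
      have := h₂ c hc
      have := h₂ e he
      have := h₃ b hb
      have := h₃ c hc
      omega

/-- An index set for the pairs `w, w + 1` of neighbouring lines meeting `A`, with one pair for each
value of `f` and one more. -/
def linePairs (A : Finset (ℤ × ℤ)) (hA : A.Nonempty) (f : ℤ × ℤ → ℤ) : Finset ℤ :=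
  insert ((A.image f).min' (hA.image f) - 1) (A.image f)

theorem card_linePairs (A : Finset (ℤ × ℤ)) (hA : A.Nonempty) (f : ℤ × ℤ → ℤ) :
    (linePairs A hA f).card = (A.image f).card + 1 := by
  rw [linePairs, Finset.card_insert_of_notMem]
  intro h
  have := (A.image f).min'_le _ h
  omega

theorem exists_of_mem_linePairs {A : Finset (ℤ × ℤ)} {hA : A.Nonempty} {f : ℤ × ℤ → ℤ} {w : ℤ}
    (hw : w ∈ linePairs A hA f) : ∃ a ∈ A, f a = w ∨ f a = w + 1 := by
  rw [linePairs, Finset.mem_insert] at hw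
  rcases hw with rfl | hw
  · obtain ⟨a, ha, h⟩ := Finset.mem_image.1 ((A.image f).min'_mem (hA.image f))
    exact ⟨a, ha, by omega⟩
  · obtain ⟨a, ha, h⟩ := Finset.mem_image.1 hw
    exact ⟨a, ha, Or.inl h⟩

/-- Only the added index, the minimum minus one, is not a value of `f`, and its predecessor is not
an index. This supplies the middle point required by `isExtremalOn_exclusive`. -/
theorem exists_of_mem_linePairs_of_sub_one_mem {A : Finset (ℤ × ℤ)} {hA : A.Nonempty}
    {f : ℤ × ℤ → ℤ} {w : ℤ} (hw : w ∈ linePairs A hA f) (hw' : w - 1 ∈ linePairs A hA f) :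
    ∃ a ∈ A, f a = w := by
  rw [linePairs, Finset.mem_insert] at hw hw'
  rcases hw with rfl | hw
  · rcases hw' with h | h
    · omega
    · have := (A.image f).min'_le _ h
      omega
  · exact Finset.mem_image.1 hw

open Classical in
theorem card_le_two_of_exclusive {s t : Finset ℤ} {P Q : ℤ → Prop} {x y : ℤ}
    (hP : ∀ w ∈ s, P w → w = x - 1 ∨ w = x) (hQ : ∀ w ∈ t, Q w → w = y - 1 ∨ w = y)
    (h : x - 1 ∈ s → x ∈ s → P (x - 1) → P x → ¬ Q (y - 1) ∧ ¬ Q y)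
    (h' : y - 1 ∈ t → y ∈ t → Q (y - 1) → Q y → ¬ P (x - 1) ∧ ¬ P x) :
    (s.filter P).card + (t.filter Q).card ≤ 2 := by
  have h1 : s.filter P ⊆ {x - 1, x} := by
    intro w hw
    rw [Finset.mem_filter] at hw
    simpa using hP w hw.1 hw.2
  have h2 : t.filter Q ⊆ {y - 1, y} := by
    intro w hw
    rw [Finset.mem_filter] at hw
    simpa using hQ w hw.1 hw.2
  have h1' := (Finset.card_le_card h1).trans Finset.card_le_two
  have h2' := (Finset.card_le_card h2).trans Finset.card_le_two
  have key : ∀ {u : Finset ℤ} {z : ℤ}, u ⊆ {z - 1, z} → 2 ≤ u.card → z - 1 ∈ u ∧ z ∈ u := by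
    intro u z hu hc
    rw [Finset.eq_of_subset_of_card_le hu (Finset.card_le_two.trans hc)]
    simp
  by_cases c1 : 2 ≤ (s.filter P).card
  · obtain ⟨m1, m2⟩ := key h1 c1
    rw [Finset.mem_filter] at m1 m2
    obtain ⟨n1, n2⟩ := h m1.1 m2.1 m1.2 m2.2
    have : t.filter Q = ∅ := by
      refine Finset.filter_eq_empty_iff.2 fun w hw hq => ?_
      rcases hQ w hw hq with rfl | rfl
      exacts [n1 hq, n2 hq]
    rw [this, Finset.card_empty]
    omega
  · by_cases c2 : 2 ≤ (t.filter Q).card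
    · obtain ⟨m1, m2⟩ := key h2 c2
      rw [Finset.mem_filter] at m1 m2
      obtain ⟨n1, n2⟩ := h' m1.1 m2.1 m1.2 m2.2
      have : s.filter P = ∅ := by
        refine Finset.filter_eq_empty_iff.2 fun w hw hq => ?_
        rcases hP w hw hq with rfl | rfl
        exacts [n1 hq, n2 hq]
      rw [this, Finset.card_empty]
      omega
    · omega

open Classical in
/-- The boundary of a finite set is at least as large as that of a box with the same diagonal
projections would be. -/
theorem card_image_add_card_image_le_boundarySize (A : Finset (ℤ × ℤ)) (hA : A.Nonempty) :
    (A.image diagU).card + (A.image diagV).card + 2 ≤ boundarySize A := by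
  -- Double counting of incidences between line pairs and boundary points: each pair has extremal
  -- points at both ends, and each point is extremal for at most two pairs. The extra pair in each
  -- direction accounts for the `+ 2`.
  set S := (linePairs A hA diagU).disjSum (linePairs A hA diagV) with hS
  let r : ℤ ⊕ ℤ → ℤ × ℤ → Prop := fun i q =>
    Sum.elim (fun w => IsExtremalOn A diagU diagV w q) (fun w => IsExtremalOn A diagV diagU w q) i
  have hmem : ∀ i q, r i q → q ∈ boundaryFinset A := by
    rintro (w | w) q h
    · refine mem_boundaryFinset.2 ⟨h.notMem, ?_⟩
      obtain ⟨h1, ⟨a, ha, h2, h3⟩, -⟩ := h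
      exact ⟨a, ha, (latticeGraph_adj_iff _ _).2 (by omega)⟩
    · refine mem_boundaryFinset.2 ⟨h.notMem, ?_⟩
      obtain ⟨h1, ⟨a, ha, h2, h3⟩, -⟩ := h
      exact ⟨a, ha, (latticeGraph_adj_iff _ _).2 (by omega)⟩
  have hm : ∀ i ∈ S, 2 ≤ ((boundaryFinset A).bipartiteAbove r i).card := by
    intro i hi
    obtain ⟨q₁, q₂, hne, h₁, h₂⟩ : ∃ q₁ q₂, q₁ ≠ q₂ ∧ r i q₁ ∧ r i q₂ := by
      rcases i with w | w
      · rw [hS, Finset.inl_mem_disjSum] at hi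
        exact exists_two_isExtremalOn A _ _ exists_diag_step w (exists_of_mem_linePairs hi)
      · rw [hS, Finset.inr_mem_disjSum] at hi
        refine exists_two_isExtremalOn A _ _ (fun p s t hs ht => ?_) w (exists_of_mem_linePairs hi)
        obtain ⟨q, h⟩ := exists_diag_step p ht hs
        exact ⟨q, h.2, h.1⟩
    refine Finset.one_lt_card.2 ⟨q₁, ?_, q₂, ?_, hne⟩
    · exact Finset.mem_filter.2 ⟨hmem _ _ h₁, h₁⟩
    · exact Finset.mem_filter.2 ⟨hmem _ _ h₂, h₂⟩
  have hn : ∀ q ∈ boundaryFinset A, (S.bipartiteBelow r q).card ≤ 2 := by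
    intro q _
    have hsplit : S.bipartiteBelow r q =
        ((linePairs A hA diagU).filter fun w => IsExtremalOn A diagU diagV w q).disjSum
          ((linePairs A hA diagV).filter fun w => IsExtremalOn A diagV diagU w q) := by
      ext (w | w) <;> simp [Finset.bipartiteBelow, hS, r]
    rw [hsplit, Finset.card_disjSum]
    refine card_le_two_of_exclusive (x := diagU q) (y := diagV q)
      (fun w _ h => ?_) (fun w _ h => ?_) ?_ ?_
    · have := h.1
      omega
    · have := h.1
      omega
    · intro m1 m2 e1 e2
      exact isExtremalOn_exclusive e1 e2 (exists_of_mem_linePairs_of_sub_one_mem m2 m1)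
    · intro m1 m2 e1 e2
      exact isExtremalOn_exclusive e1 e2 (exists_of_mem_linePairs_of_sub_one_mem m2 m1)
  have key := Finset.card_mul_le_card_mul r hm hn
  rw [hS, Finset.card_disjSum, card_linePairs, card_linePairs, card_boundaryFinset] at key
  omega

/-! ### Images under automorphisms -/

theorem vertexBoundary_image {V : Type*} {G : SimpleGraph V} (φ : G ≃g G) (A : Set V) :
    vertexBoundary G (φ '' A) = φ '' vertexBoundary G A := by
  ext u
  obtain ⟨u, rfl⟩ := φ.surjective u
  simp only [vertexBoundary, Set.mem_ofPred_eq, φ.injective.mem_set_image, Set.exists_mem_image,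
    φ.map_adj_iff]

theorem boundarySize_image (φ : latticeGraph ≃g latticeGraph) (A : Finset (ℤ × ℤ)) :
    boundarySize (A.image φ) = boundarySize A := by
  rw [boundarySize, boundarySize, Finset.coe_image, vertexBoundary_image,
    Set.ncard_image_of_injective _ φ.injective]

/-- The reflection of the lattice exchanging the two axes. -/
def latticeSwap : latticeGraph ≃g latticeGraph where
  toEquiv := Equiv.prodComm ℤ ℤ
  map_rel_iff' := by
    intro a b
    change |a.2 - b.2| + |a.1 - b.1| = 1 ↔ |a.1 - b.1| + |a.2 - b.2| = 1
    rw [add_comm]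

theorem mem_image_latticeSwap {A : Finset (ℤ × ℤ)} {x y : ℤ} :
    (x, y) ∈ A.image latticeSwap ↔ (y, x) ∈ A := by
  rw [show (x, y) = latticeSwap (y, x) from rfl, latticeSwap.injective.mem_finset_image]

/-! ### Closed neighbourhoods and rows -/

/-- The union of a set and its vertex boundary. -/
noncomputable def closedNbhd (A : Finset (ℤ × ℤ)) : Finset (ℤ × ℤ) := A ∪ boundaryFinset A

theorem card_closedNbhd (A : Finset (ℤ × ℤ)) :
    (closedNbhd A).card = A.card + boundarySize A := by
  rw [closedNbhd, Finset.card_union_of_disjoint, card_boundaryFinset]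
  exact Finset.disjoint_left.2 fun p hp hq => (mem_boundaryFinset.1 hq).1 hp

theorem mem_closedNbhd {A : Finset (ℤ × ℤ)} {x y : ℤ} : (x, y) ∈ closedNbhd A ↔
    (x, y) ∈ A ∨ (x - 1, y) ∈ A ∨ (x + 1, y) ∈ A ∨ (x, y - 1) ∈ A ∨ (x, y + 1) ∈ A := by
  rw [closedNbhd, Finset.mem_union, mem_boundaryFinset]
  constructor
  · rintro (h | ⟨-, ⟨a, b⟩, h, hab⟩)
    · exact Or.inl h
    · rw [latticeGraph_adj_iff] at hab
      simp only [diagU, diagV] at hab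
      obtain ⟨rfl, rfl⟩ | ⟨rfl, rfl⟩ | ⟨rfl, rfl⟩ | ⟨rfl, rfl⟩ :
          (a = x - 1 ∧ b = y) ∨ (a = x + 1 ∧ b = y) ∨ (a = x ∧ b = y - 1) ∨
            (a = x ∧ b = y + 1) := by omega
      all_goals tauto
  · intro h
    by_cases hx : (x, y) ∈ A
    · exact Or.inl hx
    · refine Or.inr ⟨hx, ?_⟩
      rcases h with h | h | h | h | h
      · exact absurd h hx
      all_goals
        refine ⟨_, h, (latticeGraph_adj_iff _ _).2 ?_⟩
        simp only [diagU, diagV]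
        omega

/-- The first coordinates of the points of `A` at height `y`. -/
def latticeRow (A : Finset (ℤ × ℤ)) (y : ℤ) : Finset ℤ :=
  (A.filter fun p => p.2 = y).image Prod.fst

theorem mem_latticeRow {A : Finset (ℤ × ℤ)} {x y : ℤ} : x ∈ latticeRow A y ↔ (x, y) ∈ A := by
  simp [latticeRow]

theorem card_eq_sum_card_latticeRow (A : Finset (ℤ × ℤ)) {Y : Finset ℤ}
    (hY : ∀ p ∈ A, p.2 ∈ Y) : A.card = ∑ y ∈ Y, (latticeRow A y).card := by
  rw [Finset.card_eq_sum_card_fiberwise (f := Prod.snd) (t := Y) hY]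
  refine Finset.sum_congr rfl fun y _ => ?_
  rw [latticeRow, Finset.card_image_of_injOn]
  intro p hp q hq h
  simp only [Finset.coe_filter, Set.mem_ofPred_eq] at hp hq
  exact Prod.ext h (hp.2.trans hq.2.symm)

/-- The interval of `k` integers centred at zero. -/
noncomputable def centredInterval (k : ℕ) : Finset ℤ :=
  Finset.Ico (-((k / 2 : ℕ) : ℤ)) (k - (k / 2 : ℕ))

theorem mem_centredInterval {k : ℕ} {x : ℤ} :
    x ∈ centredInterval k ↔ -((k / 2 : ℕ) : ℤ) ≤ x ∧ x < k - (k / 2 : ℕ) := by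
  simp [centredInterval]

theorem card_centredInterval (k : ℕ) : (centredInterval k).card = k := by
  rw [centredInterval, Int.card_Ico]
  omega

theorem centredInterval_mono {k l : ℕ} (h : k ≤ l) : centredInterval k ⊆ centredInterval l := by
  intro x
  rw [mem_centredInterval, mem_centredInterval]
  omega

/-! ### Compression -/

/-- Replace every row by the centred interval of the same size. -/
noncomputable def rowCompress (A : Finset (ℤ × ℤ)) : Finset (ℤ × ℤ) :=
  (A.image Prod.snd).biUnion fun y =>
    (centredInterval (latticeRow A y).card).image fun x => (x, y)

theorem mem_rowCompress {A : Finset (ℤ × ℤ)} {x y : ℤ} :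
    (x, y) ∈ rowCompress A ↔ x ∈ centredInterval (latticeRow A y).card := by
  simp only [rowCompress, Finset.mem_biUnion, Finset.mem_image, Prod.mk.injEq]
  constructor
  · rintro ⟨y', -, x', h, rfl, rfl⟩
    exact h
  · intro h
    refine ⟨y, ?_, x, h, rfl, rfl⟩
    have hc : (latticeRow A y).Nonempty := by
      rw [← Finset.card_pos, ← card_centredInterval (latticeRow A y).card]
      exact Finset.card_pos.2 ⟨x, h⟩
    obtain ⟨z, hz⟩ := hc
    exact ⟨(z, y), mem_latticeRow.1 hz, rfl⟩

theorem latticeRow_rowCompress (A : Finset (ℤ × ℤ)) (y : ℤ) :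
    latticeRow (rowCompress A) y = centredInterval (latticeRow A y).card := by
  ext x
  rw [mem_latticeRow, mem_rowCompress]

theorem card_rowCompress (A : Finset (ℤ × ℤ)) : (rowCompress A).card = A.card := by
  rw [card_eq_sum_card_latticeRow (rowCompress A) (Y := A.image Prod.snd),
    card_eq_sum_card_latticeRow A (Y := A.image Prod.snd)
      fun p hp => Finset.mem_image_of_mem _ hp]
  · simp only [latticeRow_rowCompress, card_centredInterval]
  · intro p hp
    simp only [rowCompress, Finset.mem_biUnion, Finset.mem_image] at hp
    obtain ⟨y, ⟨q, hq, rfl⟩, x, -, rfl⟩ := hp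
    exact Finset.mem_image.2 ⟨q, hq, rfl⟩

theorem card_latticeRow_add_two_le {A : Finset (ℤ × ℤ)} {y : ℤ} (h : (latticeRow A y).Nonempty) :
    (latticeRow A y).card + 2 ≤ (latticeRow (closedNbhd A) y).card := by
  set R := latticeRow A y
  have hsub : insert (R.min' h - 1) (insert (R.max' h + 1) R) ⊆ latticeRow (closedNbhd A) y := by
    intro x hx
    rw [mem_latticeRow, mem_closedNbhd]
    simp only [Finset.mem_insert] at hx
    rcases hx with rfl | rfl | hx
    · have := mem_latticeRow.1 (R.min'_mem h)
      simp only [sub_add_cancel]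
      tauto
    · have := mem_latticeRow.1 (R.max'_mem h)
      simp only [add_sub_cancel_right]
      tauto
    · exact Or.inl (mem_latticeRow.1 hx)
  refine le_trans (le_of_eq ?_) (Finset.card_le_card hsub)
  have h1 := R.min'_le_max' h
  rw [Finset.card_insert_of_notMem, Finset.card_insert_of_notMem]
  · intro hm
    have := R.le_max' _ hm
    omega
  · rw [Finset.mem_insert]
    rintro (hm | hm)
    · omega
    · have := R.min'_le _ hm
      omega

/-- Closed neighbourhoods are compared row by row. Row `y` of `closedNbhd A` is at least as long as
rows `y - 1` and `y + 1` of `A`, and longer by two than row `y` if that is nonempty. Centred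
intervals are nested, so the new row, a union of such intervals, fits into the one of the old
length. -/
theorem boundarySize_rowCompress_le (A : Finset (ℤ × ℤ)) :
    boundarySize (rowCompress A) ≤ boundarySize A := by
  have key : ∀ y, (latticeRow (closedNbhd (rowCompress A)) y).card ≤
      (latticeRow (closedNbhd A) y).card := by
    intro y
    have hrow : ∀ y', (∀ x, (x, y') ∈ A → (x, y) ∈ closedNbhd A) →
        (latticeRow A y').card ≤ (latticeRow (closedNbhd A) y).card := by
      intro y' h
      refine Finset.card_le_card fun x hx => ?_
      exact mem_latticeRow.2 (h x (mem_latticeRow.1 hx))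
    rw [← card_centredInterval (latticeRow (closedNbhd A) y).card]
    refine Finset.card_le_card fun x hx => ?_
    have hpos : ∀ z, z ∈ centredInterval (latticeRow A y).card →
        (latticeRow A y).card + 2 ≤ (latticeRow (closedNbhd A) y).card := by
      intro z hz
      refine card_latticeRow_add_two_le (Finset.card_pos.1 ?_)
      rw [← card_centredInterval (latticeRow A y).card]
      exact Finset.card_pos.2 ⟨z, hz⟩
    rw [mem_latticeRow, mem_closedNbhd] at hx
    simp only [mem_rowCompress] at hx
    rcases hx with h | h | h | h | h
    · exact centredInterval_mono
        (hrow y fun x hx => mem_closedNbhd.2 (Or.inl hx)) h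
    · refine centredInterval_mono (hpos _ h) ?_
      rw [mem_centredInterval] at h ⊢
      omega
    · refine centredInterval_mono (hpos _ h) ?_
      rw [mem_centredInterval] at h ⊢
      omega
    · exact centredInterval_mono (hrow (y - 1) fun x hx => mem_closedNbhd.2 (by tauto)) h
    · exact centredInterval_mono (hrow (y + 1) fun x hx => mem_closedNbhd.2 (by tauto)) h
  have hle : (closedNbhd (rowCompress A)).card ≤ (closedNbhd A).card := by
    rw [card_eq_sum_card_latticeRow (closedNbhd (rowCompress A))
        (Y := (closedNbhd (rowCompress A) ∪ closedNbhd A).image Prod.snd)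
        fun p hp => Finset.mem_image_of_mem _ (Finset.mem_union_left _ hp),
      card_eq_sum_card_latticeRow (closedNbhd A)
        (Y := (closedNbhd (rowCompress A) ∪ closedNbhd A).image Prod.snd)
        fun p hp => Finset.mem_image_of_mem _ (Finset.mem_union_right _ hp)]
    exact Finset.sum_le_sum fun y _ => key y
  rw [card_closedNbhd, card_closedNbhd, card_rowCompress] at hle
  omega

/-- Rows move towards the vertical axis inside `A`. -/
def RowStar (A : Finset (ℤ × ℤ)) : Prop :=
  ∀ x y, (x, y) ∈ A → (0 < x → (x - 1, y) ∈ A) ∧ (x < 0 → (x + 1, y) ∈ A)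

/-- Columns move towards the horizontal axis inside `A`. -/
def ColStar (A : Finset (ℤ × ℤ)) : Prop :=
  ∀ x y, (x, y) ∈ A → (0 < y → (x, y - 1) ∈ A) ∧ (y < 0 → (x, y + 1) ∈ A)

theorem rowStar_rowCompress (A : Finset (ℤ × ℤ)) : RowStar (rowCompress A) := by
  intro x y
  simp only [mem_rowCompress, mem_centredInterval]
  omega

/-- Under `ColStar` rows grow towards the axis, and centring respects inclusion of rows; so a second
compression, in the other direction, does not undo the first. -/
theorem ColStar.rowCompress {A : Finset (ℤ × ℤ)} (hA : ColStar A) : ColStar (rowCompress A) := by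
  intro x y h
  rw [mem_rowCompress] at h
  constructor <;> intro hy <;> rw [mem_rowCompress] <;>
    refine centredInterval_mono (Finset.card_le_card fun z hz => ?_) h <;>
    rw [mem_latticeRow] at hz ⊢
  · exact (hA z y hz).1 hy
  · exact (hA z y hz).2 hy

theorem RowStar.image_latticeSwap {A : Finset (ℤ × ℤ)} (hA : RowStar A) :
    ColStar (A.image latticeSwap) := by
  intro x y
  simp only [mem_image_latticeSwap]
  exact hA y x

theorem exists_star_of_card (A : Finset (ℤ × ℤ)) : ∃ A' : Finset (ℤ × ℤ),
    A'.card = A.card ∧ boundarySize A' ≤ boundarySize A ∧ RowStar A' ∧ ColStar A' := by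
  refine ⟨rowCompress ((rowCompress A).image latticeSwap), ?_, ?_, rowStar_rowCompress _,
    (rowStar_rowCompress A).image_latticeSwap.rowCompress⟩
  · rw [card_rowCompress, Finset.card_image_of_injective _ latticeSwap.injective, card_rowCompress]
  · refine (boundarySize_rowCompress_le _).trans ?_
    rw [boundarySize_image]
    exact boundarySize_rowCompress_le A

/-! ### The isoperimetric inequality -/

/-- Moving each element of the class of `c`, other than `c` itself, one step towards `c` is an
injection into the other class. The values 0 and -1 represent the two classes, and for both a step
towards `c` is also a step towards 0. -/
theorem card_filter_parity_le {S : Finset ℤ} (hS : ∀ x ∈ S, (0 < x → x - 1 ∈ S) ∧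
    (x < 0 → x + 1 ∈ S)) (c : ℤ) (hc : c = 0 ∨ c = -1) :
    (S.filter fun x => x % 2 = c % 2).card ≤ (S.filter fun x => x % 2 ≠ c % 2).card + 1 := by
  have h : ((S.filter fun x => x % 2 = c % 2).erase c).card ≤
      (S.filter fun x => x % 2 ≠ c % 2).card := by
    refine Finset.card_le_card_of_injOn (fun x => if c < x then x - 1 else x + 1) ?_ ?_
    · intro x hx
      simp only [Finset.coe_erase, Finset.coe_filter, Set.mem_sdiff, Set.mem_ofPred_eq,
        Set.mem_singleton_iff] at hx
      simp only [Finset.coe_filter, Set.mem_ofPred_eq]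
      have := hS x hx.1.1
      split_ifs with hcx
      · exact ⟨this.1 (by omega), by omega⟩
      · exact ⟨this.2 (by omega), by omega⟩
    · intro x hx y hy hxy
      simp only [Finset.coe_erase, Finset.coe_filter, Set.mem_sdiff, Set.mem_ofPred_eq,
        Set.mem_singleton_iff] at hx hy
      simp only at hxy
      split_ifs at hxy <;> omega
  have := Finset.pred_card_le_card_erase (s := S.filter fun x => x % 2 = c % 2) (a := c)
  omega

/-- The two diagonal coordinates of a lattice point have equal parity, so only even-even and odd-odd
pairs occur. -/
theorem card_le_of_parity (A : Finset (ℤ × ℤ)) (U V : Finset ℤ) (hU : ∀ p ∈ A, diagU p ∈ U)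
    (hV : ∀ p ∈ A, diagV p ∈ V) :
    A.card ≤ (U.filter fun x => x % 2 = 0).card * (V.filter fun x => x % 2 = 0).card +
      (U.filter fun x => ¬ x % 2 = 0).card * (V.filter fun x => ¬ x % 2 = 0).card := by
  rw [← Finset.card_product, ← Finset.card_product]
  refine le_trans ?_ (Finset.card_union_le _ _)
  refine Finset.card_le_card_of_injOn (fun p => (diagU p, diagV p)) ?_ ?_
  · intro p hp
    have h1 := hU p hp
    have h2 := hV p hp
    have h3 : diagU p % 2 = diagV p % 2 := by
      simp only [diagU, diagV]
      omega
    simp only [Finset.coe_union, Finset.coe_product, Finset.coe_filter, Set.mem_union,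
      Set.mem_prod, Set.mem_ofPred_eq]
    rw [h3]
    tauto
  · intro p _ q _ h
    rw [Prod.mk.injEq] at h
    exact diag_ext h.1 h.2

theorem star_projection {A : Finset (ℤ × ℤ)} (hr : RowStar A) (hc : ColStar A) :
    (∀ x ∈ A.image diagU, (0 < x → x - 1 ∈ A.image diagU) ∧ (x < 0 → x + 1 ∈ A.image diagU)) ∧
    (∀ x ∈ A.image diagV, (0 < x → x - 1 ∈ A.image diagV) ∧
      (x < 0 → x + 1 ∈ A.image diagV)) := by
  constructor <;>
  · intro u hu
    simp only [Finset.mem_image] at hu ⊢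
    obtain ⟨⟨x, y⟩, h, rfl⟩ := hu
    have h1 := hr x y h
    have h2 := hc x y h
    simp only [diagU, diagV]
    constructor
    · intro hpos
      by_cases hy : 0 < y
      · exact ⟨_, h2.1 hy, by simp only; omega⟩
      · first
        | exact ⟨_, h1.2 (by omega), by simp only; omega⟩
        | exact ⟨_, h1.1 (by omega), by simp only; omega⟩
    · intro hneg
      by_cases hy : y < 0
      · exact ⟨_, h2.2 hy, by simp only; omega⟩
      · first
        | exact ⟨_, h1.2 (by omega), by simp only; omega⟩
        | exact ⟨_, h1.1 (by omega), by simp only; omega⟩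

/-- The vertex-isoperimetric inequality of the square lattice. -/
theorem isoperimetric (A : Finset (ℤ × ℤ)) (hA : A.Nonempty) :
    2 ≤ boundarySize A ∧ 8 * (A.card : ℤ) ≤ ((boundarySize A : ℤ) - 2) ^ 2 + 4 := by
  obtain ⟨A', hcard, hbd, hr, hc⟩ := exists_star_of_card A
  have hA' : A'.Nonempty := by rwa [← Finset.card_pos, hcard, Finset.card_pos]
  have hlow := card_image_add_card_image_le_boundarySize A' hA'
  refine ⟨by omega, ?_⟩
  obtain ⟨hU, hV⟩ := star_projection hr hc
  have hub := card_le_of_parity A' _ _ (fun p hp => Finset.mem_image_of_mem diagU hp)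
    (fun p hp => Finset.mem_image_of_mem diagV hp)
  have hU0 := card_filter_parity_le hU 0 (Or.inl rfl)
  have hU1 := card_filter_parity_le hU (-1) (Or.inr rfl)
  have hV0 := card_filter_parity_le hV 0 (Or.inl rfl)
  have hV1 := card_filter_parity_le hV (-1) (Or.inr rfl)
  have e1 : ∀ x : ℤ, x % 2 = -1 % 2 ↔ ¬ x % 2 = 0 := fun x => by omega
  have e2 : ∀ x : ℤ, ¬ x % 2 = -1 % 2 ↔ x % 2 = 0 := fun x => by omega
  simp only [Int.zero_emod, ne_eq] at hU0 hV0
  simp only [e1, e2] at hU1 hV1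
  have hUs := Finset.card_filter_add_card_filter_not (s := A'.image diagU) (fun x => x % 2 = 0)
  have hVs := Finset.card_filter_add_card_filter_not (s := A'.image diagV) (fun x => x % 2 = 0)
  rw [hcard] at hub
  generalize ((A'.image diagU).filter fun x => x % 2 = 0).card = a at *
  generalize ((A'.image diagU).filter fun x => ¬ x % 2 = 0).card = c at *
  generalize ((A'.image diagV).filter fun x => x % 2 = 0).card = b at *
  generalize ((A'.image diagV).filter fun x => ¬ x % 2 = 0).card = d at *
  have hsum : ((a : ℤ) + c + b + d) ≤ (boundarySize A : ℤ) - 2 := by omega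
  have hsq : ((a : ℤ) + c + b + d) ^ 2 ≤ ((boundarySize A : ℤ) - 2) ^ 2 :=
    pow_le_pow_left₀ (by positivity) hsum 2
  have hub' : (A.card : ℤ) ≤ a * b + c * d := by exact_mod_cast hub
  -- With 2(ab + cd) = (a + c)(b + d) + (a - c)(b - d), the parity balance bounds the last product
  -- by 1, and the first is at most a quarter of the square of a + b + c + d.
  have hprod : ((a : ℤ) - c) * (b - d) ≤ 1 := by
    obtain h | h | h : (a : ℤ) - c = 1 ∨ (a : ℤ) - c = 0 ∨ (a : ℤ) - c = -1 := by omega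
    all_goals rw [h]; omega
  nlinarith [sq_nonneg ((a : ℤ) + c - b - d)]

/-! ### Removing points without enlarging the boundary -/

/-- Delete a leftmost point `a`. Its left neighbour has no other neighbour in `A` and leaves the
boundary, while `a` is the only point that can enter it. -/
theorem exists_boundarySize_erase_le {A : Finset (ℤ × ℤ)} (hA : A.Nonempty) :
    ∃ a ∈ A, boundarySize (A.erase a) ≤ boundarySize A := by
  obtain ⟨b, hb, hmin⟩ := Finset.exists_min_image A Prod.fst hA
  obtain ⟨a, ha, hmin'⟩ := Finset.exists_min_image (A.filter fun p => p.1 = b.1) Prod.snd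
    ⟨b, by simp [hb]⟩
  simp only [Finset.mem_filter, and_imp] at ha hmin'
  have hmin : ∀ p ∈ A, a.1 ≤ p.1 := fun p hp => by
    have := hmin p hp
    omega
  refine ⟨a, ha.1, ?_⟩
  rw [← card_boundaryFinset, ← card_boundaryFinset]
  refine Finset.card_le_card_of_injOn (fun q => if q = a then (a.1 - 1, a.2) else q) ?_ ?_
  · intro q hq
    obtain ⟨h1, c, hc, hqc⟩ := mem_boundaryFinset.1 hq
    rw [Finset.mem_erase] at hc
    simp only
    split_ifs with h
    · refine mem_boundaryFinset.2 ⟨fun hm => ?_, a, ha.1, (latticeGraph_adj_iff _ _).2 ?_⟩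
      · have := hmin _ hm
        simp only at this
        omega
      · simp only [diagU, diagV]
        omega
    · exact mem_boundaryFinset.2 ⟨fun hm => h1 (Finset.mem_erase.2 ⟨h, hm⟩), c, hc.2, hqc⟩
  · have key : ∀ q ∈ boundaryFinset (A.erase a), (a.1 - 1, a.2) ≠ q := by
      rintro q hq rfl
      obtain ⟨h1, c, hc, hqc⟩ := mem_boundaryFinset.1 hq
      rw [Finset.mem_erase] at hc
      rw [latticeGraph_adj_iff] at hqc
      simp only [diagU, diagV] at hqc
      have := hmin c hc.2
      exact hc.1 (Prod.ext (by omega) (by omega))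
    intro p hp q hq h
    simp only at h
    split_ifs at h with h1 h2 h2
    · rw [h1, h2]
    · exact absurd h (key q hq)
    · exact absurd h.symm (key p hp)
    · exact h

theorem exists_subset_card_boundarySize_le (A : Finset (ℤ × ℤ)) {k : ℕ} (hk : k ≤ A.card) :
    ∃ A' ⊆ A, A'.card = k ∧ boundarySize A' ≤ boundarySize A := by
  induction h : A.card - k generalizing A with
  | zero => exact ⟨A, subset_rfl, by omega, le_rfl⟩
  | succ n ih =>
    obtain ⟨a, ha, hle⟩ := exists_boundarySize_erase_le (A := A) (Finset.card_pos.1 (by omega))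
    have hc := Finset.card_erase_of_mem ha
    obtain ⟨A', hsub, hcard, hle'⟩ := ih (A.erase a) (by omega) (by omega)
    exact ⟨A', hsub.trans (Finset.erase_subset _ _), hcard, hle'.trans hle⟩

/-- A minimal set has no larger boundary than any set with at least as many points. -/
theorem IsMinimal.boundarySize_le {A B : Finset (ℤ × ℤ)} (hA : IsMinimal A)
    (h : A.card ≤ B.card) : boundarySize A ≤ boundarySize B := by
  obtain ⟨B', -, hcard, hle⟩ := exists_subset_card_boundarySize_le B h
  exact (hA.2 B' hcard).trans hle

/-! ### Congruence -/

theorem latticeCongruent_iff {A B : Finset (ℤ × ℤ)} : LatticeCongruent A B ↔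
    ∃ φ : latticeGraph ≃g latticeGraph, A.image φ = B := by
  refine exists_congr fun φ => ?_
  rw [← Finset.coe_inj, Finset.coe_image]

theorem IsMinimal.image {A : Finset (ℤ × ℤ)} (hA : IsMinimal A)
    (φ : latticeGraph ≃g latticeGraph) : IsMinimal (A.image φ) := by
  refine ⟨hA.1.image _, fun B hB => ?_⟩
  rw [boundarySize_image]
  exact hA.2 B (hB.trans (Finset.card_image_of_injective _ φ.injective))

theorem Represents.image {A : Finset (ℤ × ℤ)} {v : MinimalClass} (h : Represents A v)
    (φ : latticeGraph ≃g latticeGraph) : Represents (A.image φ) v := by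
  obtain ⟨hA, rfl⟩ := h
  refine ⟨hA.image φ, Quotient.sound ?_⟩
  exact latticeCongruent_iff.2 ⟨φ.symm, by simp [Finset.image_image, Function.comp_def]⟩

theorem Represents.exists_image_eq {A B : Finset (ℤ × ℤ)} {v : MinimalClass}
    (hA : Represents A v) (hB : Represents B v) :
    ∃ φ : latticeGraph ≃g latticeGraph, A.image φ = B := by
  obtain ⟨hA, rfl⟩ := hA
  obtain ⟨hB, h⟩ := hB
  exact latticeCongruent_iff.1 (Quotient.exact h.symm)

theorem represents_minimalClass {A : Finset (ℤ × ℤ)} (hA : IsMinimal A) :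
    Represents A (minimalClass A hA) := ⟨hA, rfl⟩

/-! ### Automorphisms of the lattice -/

theorem latticeGraph_adj_of_sub_eq {p q r s : ℤ × ℤ} (h : p - q = r - s)
    (hrs : latticeGraph.Adj r s) : latticeGraph.Adj p q := by
  change |r.1 - s.1| + |r.2 - s.2| = 1 at hrs
  change |p.1 - q.1| + |p.2 - q.2| = 1
  rwa [← Prod.fst_sub, ← Prod.snd_sub, h]

/-- The points `p + e` and `p - e` have `p` as their only common neighbour. Reflecting `φ p` in the
midpoint of their images gives a common neighbour of the images, which must be `φ p` again. -/
theorem latticeAut_opposite (φ : latticeGraph ≃g latticeGraph) (p e : ℤ × ℤ)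
    (he : latticeGraph.Adj e 0) : φ (p + e) + φ (p - e) = φ p + φ p := by
  have h1 : latticeGraph.Adj (φ (p + e)) (φ p) :=
    φ.map_adj_iff.2 (latticeGraph_adj_of_sub_eq (by abel) he)
  have h2 : latticeGraph.Adj (φ (p - e)) (φ p) :=
    φ.map_adj_iff.2 (latticeGraph_adj_of_sub_eq (by abel) he.symm)
  obtain ⟨r, hr⟩ := φ.surjective (φ (p + e) + φ (p - e) - φ p)
  have h3 : latticeGraph.Adj r (p + e) := by
    rw [← φ.map_adj_iff, hr]
    exact latticeGraph_adj_of_sub_eq (by abel) h2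
  have h4 : latticeGraph.Adj r (p - e) := by
    rw [← φ.map_adj_iff, hr]
    exact latticeGraph_adj_of_sub_eq (by abel) h1
  have hrp : r = p := by
    rw [latticeGraph_adj_iff] at h3 h4 he
    simp only [diagU, diagV, Prod.fst_add, Prod.snd_add, Prod.fst_sub, Prod.snd_sub,
      Prod.fst_zero, Prod.snd_zero] at h3 h4 he
    clear hr
    exact Prod.ext (by omega) (by omega)
  rw [← sub_eq_iff_eq_add, ← hr, hrp]

theorem latticeGraph_adj_one_zero : latticeGraph.Adj (1, 0) 0 := by
  simp [latticeGraph_adj_iff, diagU, diagV]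

theorem latticeGraph_adj_zero_one : latticeGraph.Adj (0, 1) 0 := by
  simp [latticeGraph_adj_iff, diagU, diagV]

/-- Here there are two common neighbours, `p` and the opposite corner. The first would make the two
images opposite at `φ p`, a position already taken by the image of `p - (0, 1)`. -/
theorem latticeAut_parallelogram (φ : latticeGraph ≃g latticeGraph) (p : ℤ × ℤ) :
    φ (p + (1, 0) + (0, 1)) + φ p = φ (p + (1, 0)) + φ (p + (0, 1)) := by
  have h1 : latticeGraph.Adj (φ (p + (1, 0))) (φ p) :=
    φ.map_adj_iff.2 (latticeGraph_adj_of_sub_eq (by abel) latticeGraph_adj_one_zero)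
  have h2 : latticeGraph.Adj (φ (p + (0, 1))) (φ p) :=
    φ.map_adj_iff.2 (latticeGraph_adj_of_sub_eq (by abel) latticeGraph_adj_zero_one)
  obtain ⟨r, hr⟩ := φ.surjective (φ (p + (1, 0)) + φ (p + (0, 1)) - φ p)
  have h3 : latticeGraph.Adj r (p + (1, 0)) := by
    rw [← φ.map_adj_iff, hr]
    exact latticeGraph_adj_of_sub_eq (by abel) h2
  have h4 : latticeGraph.Adj r (p + (0, 1)) := by
    rw [← φ.map_adj_iff, hr]
    exact latticeGraph_adj_of_sub_eq (by abel) h1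
  have hrp : r = p ∨ r = p + (1, 0) + (0, 1) := by
    rw [latticeGraph_adj_iff] at h3 h4
    simp only [diagU, diagV, Prod.fst_add, Prod.snd_add, Prod.ext_iff] at h3 h4 ⊢
    clear hr h1 h2
    omega
  rcases hrp with rfl | rfl
  · have hopp := latticeAut_opposite φ r (0, 1) latticeGraph_adj_zero_one
    have : φ (r + (1, 0)) = φ (r - (0, 1)) := by
      rw [eq_sub_iff_add_eq, ← hopp, add_comm (φ (r + (0, 1)))] at hr
      exact (add_right_cancel hr).symm
    have := congrArg Prod.fst (φ.injective this)
    simp at this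
  · rw [hr, sub_add_cancel]

theorem eq_zero_of_lattice_invariant {α : Type*} {F : ℤ × ℤ → α}
    (h1 : ∀ p, F (p + (1, 0)) = F p) (h2 : ∀ p, F (p + (0, 1)) = F p) (p : ℤ × ℤ) :
    F p = F 0 := by
  have hx : ∀ x y : ℤ, F (x, y) = F (0, y) := by
    intro x y
    induction x with
    | zero => rfl
    | succ n ih => rw [← ih, ← h1 ((n : ℤ), y)]; simp
    | pred n ih => rw [← ih, ← h1 (_, y)]; simp
  have hy : ∀ y : ℤ, F (0, y) = F 0 := by
    intro y
    induction y with
    | zero => rfl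
    | succ n ih => rw [← ih, ← h2 (0, (n : ℤ))]; simp
    | pred n ih => rw [← ih, ← h2 (0, _)]; simp
  rw [← hy p.2, ← hx p.1 p.2]

theorem latticeAut_affine (φ : latticeGraph ≃g latticeGraph) (p : ℤ × ℤ) :
    φ p = φ 0 + p.1 • (φ (1, 0) - φ 0) + p.2 • (φ (0, 1) - φ 0) := by
  have h11 : ∀ p, φ (p + (1, 0) + (1, 0)) + φ p = φ (p + (1, 0)) + φ (p + (1, 0)) := by
    intro p
    have := latticeAut_opposite φ (p + (1, 0)) (1, 0) latticeGraph_adj_one_zero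
    rwa [add_sub_cancel_right] at this
  have h22 : ∀ p, φ (p + (0, 1) + (0, 1)) + φ p = φ (p + (0, 1)) + φ (p + (0, 1)) := by
    intro p
    have := latticeAut_opposite φ (p + (0, 1)) (0, 1) latticeGraph_adj_zero_one
    rwa [add_sub_cancel_right] at this
  have h12 := latticeAut_parallelogram φ
  have d1 : ∀ p, φ (p + (1, 0)) - φ p = φ (1, 0) - φ 0 := by
    intro p
    rw [eq_zero_of_lattice_invariant (F := fun p => φ (p + (1, 0)) - φ p) ?_ ?_ p, zero_add]
    · intro p
      rw [sub_eq_sub_iff_add_eq_add, h11]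
    · intro p
      rw [sub_eq_sub_iff_add_eq_add, add_right_comm, h12]
  have d2 : ∀ p, φ (p + (0, 1)) - φ p = φ (0, 1) - φ 0 := by
    intro p
    rw [eq_zero_of_lattice_invariant (F := fun p => φ (p + (0, 1)) - φ p) ?_ ?_ p, zero_add]
    · intro p
      rw [sub_eq_sub_iff_add_eq_add, h12, add_comm]
    · intro p
      rw [sub_eq_sub_iff_add_eq_add, h22]
  have key := eq_zero_of_lattice_invariant
    (F := fun p => φ p - p.1 • (φ (1, 0) - φ 0) - p.2 • (φ (0, 1) - φ 0)) ?_ ?_ p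
  · simp only [Prod.fst_zero, Prod.snd_zero, zero_smul, sub_zero] at key
    rw [sub_sub, sub_eq_iff_eq_add, ← add_assoc] at key
    exact key
  · intro p
    rw [← d1 p]
    simp only [Prod.fst_add, Prod.snd_add, add_smul, one_smul, add_zero]
    abel
  · intro p
    rw [← d2 p]
    simp only [Prod.fst_add, Prod.snd_add, add_smul, one_smul, add_zero]
    abel

/-- An automorphism of the lattice acts on the diagonal coordinates by signs, translations and
possibly by exchanging them. -/
theorem latticeAut_diag (φ : latticeGraph ≃g latticeGraph) : ∃ s t c e : ℤ,
    (s = 1 ∨ s = -1) ∧ (t = 1 ∨ t = -1) ∧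
    ((∀ p, diagU (φ p) = s * diagU p + c ∧ diagV (φ p) = t * diagV p + e) ∨
      (∀ p, diagU (φ p) = s * diagV p + c ∧ diagV (φ p) = t * diagU p + e)) := by
  have h1 := φ.map_adj_iff.2 latticeGraph_adj_one_zero
  have h2 := φ.map_adj_iff.2 latticeGraph_adj_zero_one
  have h3 : φ (1, 0) ≠ φ (0, 1) := fun h => by simpa using φ.injective h
  have h4 : φ (1, 0) + φ (0, 1) ≠ φ 0 + φ 0 := by
    rw [← latticeAut_opposite φ 0 (1, 0) latticeGraph_adj_one_zero, zero_add]
    intro h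
    simpa using φ.injective (add_left_cancel h)
  have key := latticeAut_affine φ
  rw [latticeGraph_adj_iff] at h1 h2
  generalize φ (1, 0) = a at *
  generalize φ (0, 1) = b at *
  generalize φ 0 = o at *
  have hU : ∀ p, diagU (φ p) =
      diagU o + p.1 * (diagU a - diagU o) + p.2 * (diagU b - diagU o) := by
    intro p
    rw [key p]
    simp only [diagU, Prod.fst_add, Prod.snd_add, Prod.smul_fst, Prod.smul_snd, Prod.fst_sub,
      Prod.snd_sub, smul_eq_mul]
    ring
  have hV : ∀ p, diagV (φ p) =
      diagV o + p.1 * (diagV a - diagV o) + p.2 * (diagV b - diagV o) := by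
    intro p
    rw [key p]
    simp only [diagV, Prod.fst_add, Prod.snd_add, Prod.smul_fst, Prod.smul_snd, Prod.fst_sub,
      Prod.snd_sub, smul_eq_mul]
    ring
  have h3' : ¬ (diagU a = diagU b ∧ diagV a = diagV b) := fun h => h3 (diag_ext h.1 h.2)
  have h4' : ¬ (diagU a + diagU b = 2 * diagU o ∧ diagV a + diagV b = 2 * diagV o) := by
    simp only [diagU, diagV, Prod.ext_iff, Prod.fst_add, Prod.snd_add, ne_eq] at h4 ⊢
    omega
  generalize diagU a = ua at *
  generalize diagU b = ub at *
  generalize diagU o = uo at *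
  generalize diagV a = va at *
  generalize diagV b = vb at *
  generalize diagV o = vo at *
  clear key h3 h4
  simp only [diagU, diagV] at hU hV ⊢
  refine ⟨ub - uo, vb - vo, uo, vo, by omega, by omega, ?_⟩
  by_cases hcase : ua - uo = -(ub - uo)
  · have : va - vo = vb - vo := by omega
    left
    intro p
    rw [hU, hV, hcase, this]
    constructor <;> ring
  · have h : ua - uo = ub - uo := by omega
    have : va - vo = -(vb - vo) := by omega
    right
    intro p
    rw [hU, hV, h, this]
    constructor <;> ring

/-! ### Boxes -/

theorem mem_of_coe_eq_boxRegion {B : Finset (ℤ × ℤ)} {a b c d : ℤ}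
    (hB : (B : Set (ℤ × ℤ)) = boxRegion a b c d) {p : ℤ × ℤ} :
    p ∈ B ↔ (a ≤ diagU p ∧ diagU p ≤ b) ∧ (c ≤ diagV p ∧ diagV p ≤ d) := by
  rw [← Finset.mem_coe, hB]
  rfl

theorem boundarySize_box_le {B : Finset (ℤ × ℤ)} {a b c d : ℤ}
    (hB : (B : Set (ℤ × ℤ)) = boxRegion a b c d) (hab : a ≤ b) (hcd : c ≤ d) :
    (boundarySize B : ℤ) ≤ (b - a) + (d - c) + 4 := by
  -- `t` is the distance travelled once around the frame of the box, of perimeter 2((b - a) + (d -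
  -- c) + 4). Lattice points have diagonal coordinates of equal parity, so `t` has constant parity
  -- on them and `t / 2` is still injective.
  let t : ℤ × ℤ → ℤ := fun q =>
    if diagV q = c - 1 then diagU q - (a - 1)
    else if diagU q = b + 1 then (b - a + 2) + (diagV q - (c - 1))
    else if diagV q = d + 1 then (b - a + 2) + (d - c + 2) + (b + 1 - diagU q)
    else 2 * (b - a + 2) + (d - c + 2) + (d + 1 - diagV q)
  have hframe : ∀ q ∈ boundaryFinset B, (a - 1 ≤ diagU q ∧ diagU q ≤ b + 1) ∧
      (c - 1 ≤ diagV q ∧ diagV q ≤ d + 1) ∧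
      (diagV q = c - 1 ∨ diagU q = b + 1 ∨ diagV q = d + 1 ∨ diagU q = a - 1) := by
    intro q hq
    obtain ⟨h1, p, hp, hqp⟩ := mem_boundaryFinset.1 hq
    rw [mem_of_coe_eq_boxRegion hB] at h1 hp
    rw [latticeGraph_adj_iff] at hqp
    omega
  have hle : (boundaryFinset B).card ≤ (Finset.Ico (0 : ℤ) ((b - a) + (d - c) + 4)).card := by
    refine Finset.card_le_card_of_injOn (fun q => t q / 2) ?_ ?_
    · intro q hq
      have := hframe q hq
      simp only [t, Finset.coe_Ico, Set.mem_Ico]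
      split_ifs <;> omega
    · intro p hp q hq h
      obtain ⟨p1, p2, p3⟩ := hframe p hp
      obtain ⟨q1, q2, q3⟩ := hframe q hq
      have hpar : diagU p % 2 = diagV p % 2 := by
        simp only [diagU, diagV]
        omega
      have hpar' : diagU q % 2 = diagV q % 2 := by
        simp only [diagU, diagV]
        omega
      simp only [t] at h
      clear_value t
      clear hframe hp hq
      refine diag_ext ?_ ?_ <;> split_ifs at h <;> omega
  rw [card_boundaryFinset, Int.card_Ico] at hle
  omega

theorem image_diag_box {B : Finset (ℤ × ℤ)} {a b c d : ℤ}
    (hB : (B : Set (ℤ × ℤ)) = boxRegion a b c d) (hab : a < b) (hcd : c < d) :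
    B.image diagU = Finset.Icc a b ∧ B.image diagV = Finset.Icc c d := by
  constructor <;> ext w <;>
    simp only [Finset.mem_image, Finset.mem_Icc, mem_of_coe_eq_boxRegion hB]
  · constructor
    · rintro ⟨p, hp, rfl⟩
      exact hp.1
    · intro hw
      -- The point with u = w and v equal to c or c + 1, whichever has the parity of w; two lines in
      -- the other direction are needed for this.
      refine ⟨((c + (w - c) % 2 - w) / 2, (c + (w - c) % 2 + w) / 2), ?_⟩
      simp only [diagU, diagV]
      omega
  · constructor
    · rintro ⟨p, hp, rfl⟩
      exact hp.2
    · intro hw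
      refine ⟨((w - (a + (w - a) % 2)) / 2, (w + (a + (w - a) % 2)) / 2), ?_⟩
      simp only [diagU, diagV]
      omega

theorem IsBox.image {B : Finset (ℤ × ℤ)} (hB : IsBox B) (φ : latticeGraph ≃g latticeGraph) :
    IsBox (B.image φ) := by
  obtain ⟨hne, a, b, c, d, hB⟩ := hB
  refine ⟨hne.image φ, ?_⟩
  have hmem : ∀ q, q ∈ B.image φ ↔ (a ≤ diagU (φ.symm q) ∧ diagU (φ.symm q) ≤ b) ∧
      (c ≤ diagV (φ.symm q) ∧ diagV (φ.symm q) ≤ d) := by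
    intro q
    rw [← mem_of_coe_eq_boxRegion hB]
    conv_lhs => rw [← φ.apply_symm_apply q]
    exact φ.injective.mem_finset_image
  have hext : ∀ {a' b' c' d' : ℤ}, (∀ q, q ∈ B.image φ ↔ (a' ≤ diagU q ∧ diagU q ≤ b') ∧
      (c' ≤ diagV q ∧ diagV q ≤ d')) → (B.image φ : Set (ℤ × ℤ)) = boxRegion a' b' c' d' :=
    fun h => Set.ext h
  obtain ⟨s, t, e, f, rfl | rfl, rfl | rfl, h | h⟩ := latticeAut_diag φ.symm
  · exact ⟨a - e, b - e, c - f, d - f, hext fun q => by rw [hmem, (h q).1, (h q).2]; omega⟩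
  · exact ⟨c - f, d - f, a - e, b - e, hext fun q => by rw [hmem, (h q).1, (h q).2]; omega⟩
  · exact ⟨a - e, b - e, f - d, f - c, hext fun q => by rw [hmem, (h q).1, (h q).2]; omega⟩
  · exact ⟨f - d, f - c, a - e, b - e, hext fun q => by rw [hmem, (h q).1, (h q).2]; omega⟩
  · exact ⟨e - b, e - a, c - f, d - f, hext fun q => by rw [hmem, (h q).1, (h q).2]; omega⟩
  · exact ⟨c - f, d - f, e - b, e - a, hext fun q => by rw [hmem, (h q).1, (h q).2]; omega⟩
  · exact ⟨e - b, e - a, f - d, f - c, hext fun q => by rw [hmem, (h q).1, (h q).2]; omega⟩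
  · exact ⟨f - d, f - c, e - b, e - a, hext fun q => by rw [hmem, (h q).1, (h q).2]; omega⟩

theorem image_symm_image (φ : latticeGraph ≃g latticeGraph) (A : Finset (ℤ × ℤ)) :
    (A.image φ).image φ.symm = A := by
  simp [Finset.image_image, Function.comp_def]

theorem image_image_symm (φ : latticeGraph ≃g latticeGraph) (A : Finset (ℤ × ℤ)) :
    (A.image φ.symm).image φ = A := by
  simp [Finset.image_image, Function.comp_def]

theorem IsEnclosingBox.image {A E : Finset (ℤ × ℤ)} (h : IsEnclosingBox A E)
    (φ : latticeGraph ≃g latticeGraph) : IsEnclosingBox (A.image φ) (E.image φ) := by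
  refine ⟨⟨h.1.1.image φ, Finset.image_subset_image h.1.2⟩, ?_⟩
  rintro E' ⟨hbox, hsub⟩
  have h' : E ≤ E'.image φ.symm := by
    refine h.2 ⟨hbox.image φ.symm, ?_⟩
    rw [← image_symm_image φ A]
    exact Finset.image_subset_image hsub
  rw [← image_image_symm φ E']
  exact Finset.image_subset_image h'

theorem isEnclosingBox_of_image_eq {A B : Finset (ℤ × ℤ)} (hB : IsBox B) (hAB : A ⊆ B)
    (hU : B.image diagU ⊆ A.image diagU) (hV : B.image diagV ⊆ A.image diagV) :
    IsEnclosingBox A B := by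
  refine ⟨⟨hB, hAB⟩, ?_⟩
  rintro E ⟨⟨-, a, b, c, d, hE⟩, hAE⟩ p hp
  rw [mem_of_coe_eq_boxRegion hE]
  obtain ⟨q, hq, hqp⟩ := Finset.mem_image.1 (hU (Finset.mem_image_of_mem diagU hp))
  obtain ⟨r, hr, hrp⟩ := Finset.mem_image.1 (hV (Finset.mem_image_of_mem diagV hp))
  have h1 := (mem_of_coe_eq_boxRegion hE).1 (hAE hq)
  have h2 := (mem_of_coe_eq_boxRegion hE).1 (hAE hr)
  omega

/-- A subset missing fewer points than every fibre of `f` has, has the same image under `f`. -/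
theorem image_subset_image_of_card {α β : Type*} [DecidableEq α] [DecidableEq β] {A B : Finset α}
    (f : α → β) {n : ℕ} (hAB : A ⊆ B) (hcard : B.card ≤ A.card + n)
    (hf : ∀ p ∈ B, n < (B.filter fun q => f q = f p).card) : B.image f ⊆ A.image f := by
  intro w hw
  obtain ⟨p, hp, rfl⟩ := Finset.mem_image.1 hw
  by_contra hcon
  have hsub : (B.filter fun q => f q = f p) ⊆ B \ A := by
    intro q hq
    rw [Finset.mem_filter] at hq
    refine Finset.mem_sdiff.2 ⟨hq.1, fun hqA => hcon ?_⟩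
    rw [← hq.2]
    exact Finset.mem_image_of_mem f hqA
  have h1 := Finset.card_le_card hsub
  have h2 := Finset.card_sdiff_add_card_eq_card hAB
  have h3 := hf p hp
  omega

theorem card_symmDiff_eq_one {α : Type*} [DecidableEq α] {A B : Finset α}
    (h : (A ∆ B).card = 1) : (∃ x ∉ A, B = insert x A) ∨ (∃ x ∉ B, A = insert x B) := by
  obtain ⟨x, hx⟩ := Finset.card_eq_one.1 h
  have hmem : ∀ y, (y ∈ A ∧ y ∉ B ∨ y ∈ B ∧ y ∉ A) ↔ y = x := by
    intro y
    rw [← Finset.mem_symmDiff, hx, Finset.mem_singleton]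
  by_cases hxA : x ∈ A
  · have hxB : x ∉ B := by
      have := (hmem x).2 rfl
      tauto
    refine Or.inr ⟨x, hxB, ?_⟩
    ext y
    rw [Finset.mem_insert, ← hmem y]
    have := hmem y
    by_cases hy : y = x
    · subst hy
      tauto
    · tauto
  · refine Or.inl ⟨x, hxA, ?_⟩
    ext y
    rw [Finset.mem_insert, ← hmem y]
    have := hmem y
    by_cases hy : y = x
    · subst hy
      tauto
    · tauto

theorem card_image_symmDiff {A B : Finset (ℤ × ℤ)} (φ : latticeGraph ≃g latticeGraph) :
    ((A.image φ) ∆ (B.image φ)).card = (A ∆ B).card := by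
  rw [← Finset.image_symmDiff _ _ φ.injective, Finset.card_image_of_injective _ φ.injective]

/-! ### Removing points one at a time -/

open Classical in
/-- Remove a point whose removal does not enlarge the boundary. -/
noncomputable def removePoint (A : Finset (ℤ × ℤ)) : Finset (ℤ × ℤ) :=
  if h : A.Nonempty then A.erase (exists_boundarySize_erase_le h).choose else A

theorem exists_removePoint_eq {A : Finset (ℤ × ℤ)} (h : A.Nonempty) :
    ∃ a ∈ A, removePoint A = A.erase a ∧ boundarySize (removePoint A) ≤ boundarySize A := by
  have := (exists_boundarySize_erase_le h).choose_spec
  rw [removePoint, dif_pos h]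
  exact ⟨_, this.1, rfl, this.2⟩

theorem removePoint_subset (A : Finset (ℤ × ℤ)) : removePoint A ⊆ A := by
  rw [removePoint]
  split_ifs
  · exact Finset.erase_subset _ _
  · exact subset_rfl

theorem iterate_removePoint_antitone (A : Finset (ℤ × ℤ)) :
    Antitone fun j => removePoint^[j] A := by
  refine antitone_nat_of_succ_le fun n => ?_
  rw [Function.iterate_succ_apply']
  exact removePoint_subset _

theorem iterate_removePoint_spec (A : Finset (ℤ × ℤ)) {j : ℕ} (hj : j ≤ A.card) :
    (removePoint^[j] A).card + j = A.card ∧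
      boundarySize (removePoint^[j] A) ≤ boundarySize A := by
  induction j with
  | zero => simp
  | succ j ih =>
    obtain ⟨h1, h2⟩ := ih (by omega)
    rw [Function.iterate_succ_apply']
    obtain ⟨a, ha, he, hle⟩ := exists_removePoint_eq (A := removePoint^[j] A)
      (Finset.card_pos.1 (by omega))
    refine ⟨?_, hle.trans h2⟩
    rw [he, Finset.card_erase_of_mem ha]
    have := Finset.card_pos.2 ⟨a, ha⟩
    omega

/-! ### The component of a dead box with long lines -/

theorem IsDead.not_isMinimal_insert {A : Finset (ℤ × ℤ)} (hA : IsDead A) {x : ℤ × ℤ}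
    (hx : x ∉ A) : ¬ IsMinimal (insert x A) := by
  intro hmin
  have h0 := hA.2
  have h1 : ((1 : ℕ) : ℕ∞) ≤ lifeExpectancy A := by
    refine le_iSup₂_of_le 1 ⟨![A, insert x A], rfl, ?_, ?_⟩ le_rfl
    · rw [Fin.monotone_iff_le_succ]
      intro i
      fin_cases i
      exact Finset.subset_insert x A
    · intro i
      fin_cases i
      · exact ⟨hA.1, rfl⟩
      · exact ⟨hmin, Finset.card_insert_of_notMem hx⟩
  rw [h0] at h1
  simp at h1

/-- The hypotheses on a box under which its component is finite. -/
structure IsDeadBoxWithLongLines (B : Finset (ℤ × ℤ)) (d : ℕ) : Prop where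
  isBox : IsBox B
  isDead : IsDead B
  excess_eq : excess B = d
  card_lineU : ∀ p ∈ B, d + 1 < (B.filter fun q => diagU q = diagU p).card
  card_lineV : ∀ p ∈ B, d + 1 < (B.filter fun q => diagV q = diagV p).card
  boundarySize_le : boundarySize B ≤ (B.image diagU).card + (B.image diagV).card + 2

namespace IsDeadBoxWithLongLines

variable {A B : Finset (ℤ × ℤ)} {d : ℕ}

theorem boundarySize_eq (h : IsDeadBoxWithLongLines B d) :
    boundarySize B = (B.image diagU).card + (B.image diagV).card + 2 :=
  le_antisymm h.boundarySize_le
    (card_image_add_card_image_le_boundarySize B h.isDead.1.1)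

theorem exists_isMinimal (h : IsDeadBoxWithLongLines B d) : ∃ B₀ : Finset (ℤ × ℤ),
    IsMinimal B₀ ∧ boundarySize B₀ = boundarySize B ∧ B.card = B₀.card + d := by
  have := h.isDead.1.excess_isGreatest
  rw [h.excess_eq] at this
  obtain ⟨B₀, h1, h2, h3⟩ := this.1
  exact ⟨B₀, h1, h2.symm, by omega⟩

theorem card_le_of_boundarySize_eq (h : IsDeadBoxWithLongLines B d) (hA : IsMinimal A)
    (hAB : boundarySize A = boundarySize B) : B.card ≤ A.card + d := by
  have := h.isDead.1.excess_isGreatest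
  rw [h.excess_eq] at this
  have := this.2 ⟨A, hA, hAB.symm, rfl⟩
  omega

theorem image_subset (h : IsDeadBoxWithLongLines B d) (hAB : A ⊆ B)
    (hcard : B.card ≤ A.card + (d + 1)) :
    B.image diagU ⊆ A.image diagU ∧ B.image diagV ⊆ A.image diagV :=
  ⟨image_subset_image_of_card _ hAB hcard h.card_lineU,
    image_subset_image_of_card _ hAB hcard h.card_lineV⟩

/-- The allowance is d + 1 rather than d, so that it still applies to a set one point below the
expected range; this is how `card_le_of_isMinimal` excludes such sets. -/
theorem boundarySize_le_of_subset (h : IsDeadBoxWithLongLines B d) (hAB : A ⊆ B)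
    (hcard : B.card ≤ A.card + (d + 1)) : boundarySize B ≤ boundarySize A := by
  obtain ⟨hU, hV⟩ := h.image_subset hAB hcard
  have hA : A.Nonempty := Finset.image_nonempty.1 ((h.isDead.1.1.image diagU).mono hU)
  have := card_image_add_card_image_le_boundarySize A hA
  have := Finset.card_le_card hU
  have := Finset.card_le_card hV
  have := h.boundarySize_eq
  omega

theorem isMinimal_of_subset (h : IsDeadBoxWithLongLines B d)
    (hcard : B.card ≤ A.card + d) (hbd : boundarySize A ≤ boundarySize B) : IsMinimal A := by
  obtain ⟨B₀, h1, h2, h3⟩ := h.exists_isMinimal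
  have := Finset.card_pos.2 h1.1
  refine ⟨Finset.card_pos.1 (by omega), fun C hC => ?_⟩
  rw [← h2] at hbd
  exact hbd.trans (h1.boundarySize_le (by omega))

/-- When `A` is not all of `B`, minimality bounds the boundary of `insert x A` by that of `B`. The
projection bound then leaves no room for a new line in either direction, so both coordinates of `x`
are in the range of the box. -/
theorem insert_subset (h : IsDeadBoxWithLongLines B d) (hAB : A ⊆ B)
    (hcard : B.card ≤ A.card + d) {x : ℤ × ℤ} (hx : x ∉ A) (hmin : IsMinimal (insert x A)) :
    insert x A ⊆ B := by
  refine Finset.insert_subset ?_ hAB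
  by_contra hxB
  rcases hAB.eq_or_ssubset with rfl | hss
  · exact h.isDead.not_isMinimal_insert hx hmin
  · have hlt := Finset.card_lt_card hss
    have hle := hmin.boundarySize_le (B := B) (by rw [Finset.card_insert_of_notMem hx]; omega)
    obtain ⟨hU, hV⟩ := h.image_subset hAB (by omega)
    have hlow := card_image_add_card_image_le_boundarySize _ hmin.1
    have hU' : B.image diagU ⊆ (insert x A).image diagU :=
      hU.trans (Finset.image_subset_image (Finset.subset_insert x A))
    have hV' : B.image diagV ⊆ (insert x A).image diagV :=
      hV.trans (Finset.image_subset_image (Finset.subset_insert x A))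
    have hUc := Finset.card_le_card hU'
    have hVc := Finset.card_le_card hV'
    have heq := h.boundarySize_eq
    have hUe := Finset.eq_of_subset_of_card_le hU' (by omega)
    have hVe := Finset.eq_of_subset_of_card_le hV' (by omega)
    have hxU : diagU x ∈ B.image diagU := by
      rw [hUe]
      exact Finset.mem_image_of_mem _ (Finset.mem_insert_self x A)
    have hxV : diagV x ∈ B.image diagV := by
      rw [hVe]
      exact Finset.mem_image_of_mem _ (Finset.mem_insert_self x A)
    obtain ⟨p, hp, hpx⟩ := Finset.mem_image.1 hxU
    obtain ⟨q, hq, hqx⟩ := Finset.mem_image.1 hxV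
    obtain ⟨-, a, b, c, e, hB⟩ := h.isBox
    rw [mem_of_coe_eq_boxRegion hB] at hxB hp hq
    omega

theorem card_le_of_isMinimal (h : IsDeadBoxWithLongLines B d) (hAB : A ⊆ B)
    (hcard : B.card ≤ A.card + (d + 1)) (hmin : IsMinimal A) : B.card ≤ A.card + d :=
  h.card_le_of_boundarySize_eq hmin
    (le_antisymm (hmin.boundarySize_le (Finset.card_le_card hAB))
      (h.boundarySize_le_of_subset hAB hcard))

/-- The class has a representative inside `B` missing at most `d` points of `B`. -/
def Below (B : Finset (ℤ × ℤ)) (d : ℕ) (v : MinimalClass) : Prop :=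
  ∃ A, Represents A v ∧ A ⊆ B ∧ B.card ≤ A.card + d

/-- An automorphism carries the representative on the edge to the one inside `B`, so the neighbour
arises by adding or deleting one point there. -/
theorem below_of_adj (h : IsDeadBoxWithLongLines B d) {v w : MinimalClass} (hv : Below B d v)
    (hvw : minimalSetGraph.Adj v w) : Below B d w := by
  obtain ⟨A, hA, hAB, hcard⟩ := hv
  obtain ⟨A₁, B₁, hA₁, hB₁, h1⟩ := hvw
  obtain ⟨φ, rfl⟩ := hA₁.exists_image_eq hA
  rw [← card_image_symmDiff φ] at h1
  have hw := hB₁.image φ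
  obtain ⟨hmin, -⟩ := id hw
  rcases card_symmDiff_eq_one h1 with ⟨x, hx, he⟩ | ⟨x, hx, he⟩
  · rw [he] at hw hmin
    refine ⟨_, hw, h.insert_subset hAB hcard hx hmin, ?_⟩
    rw [Finset.card_insert_of_notMem hx]
    omega
  · have hsub : B₁.image φ ⊆ A₁.image φ := by
      rw [he]
      exact Finset.subset_insert _ _
    rw [he, Finset.card_insert_of_notMem hx] at hcard
    exact ⟨_, hw, hsub.trans hAB, h.card_le_of_isMinimal (hsub.trans hAB) (by omega) hmin⟩

variable {C : minimalSetGraph.ConnectedComponent}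

theorem below_of_mem_supp (h : IsDeadBoxWithLongLines B d) (hC : B ∈ setsInComponent C)
    {v : MinimalClass} (hv : v ∈ C.supp) : Below B d v := by
  obtain ⟨u, hu, hBu⟩ := hC
  rw [SimpleGraph.ConnectedComponent.mem_supp_iff] at hu hv
  obtain ⟨p⟩ := SimpleGraph.ConnectedComponent.exact (hu.trans hv.symm)
  have hu' : Below B d u := ⟨B, hBu, subset_rfl, by omega⟩
  clear hu hv hBu
  induction p with
  | nil => exact hu'
  | cons hadj _ ih => exact ih (h.below_of_adj hu' hadj)

theorem of_mem_setsInComponent (h : IsDeadBoxWithLongLines B d) (hC : B ∈ setsInComponent C)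
    (hA : A ∈ setsInComponent C) : B.card ≤ A.card + d ∧ A.card ≤ B.card ∧
      ∃ E : Finset (ℤ × ℤ), IsEnclosingBox A E ∧ LatticeCongruent E B := by
  obtain ⟨v, hv, hAv⟩ := hA
  obtain ⟨A₀, hA₀, hAB, hcard⟩ := h.below_of_mem_supp hC hv
  obtain ⟨φ, rfl⟩ := hA₀.exists_image_eq hAv
  rw [Finset.card_image_of_injective _ φ.injective]
  obtain ⟨hU, hV⟩ := h.image_subset hAB (by omega)
  exact ⟨hcard, Finset.card_le_card hAB, B.image φ,
    (isEnclosingBox_of_image_eq h.isBox hAB hU hV).image φ,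
    latticeCongruent_iff.2 ⟨φ.symm, image_symm_image φ B⟩⟩

theorem finite_supp (h : IsDeadBoxWithLongLines B d) (hC : B ∈ setsInComponent C) :
    C.supp.Finite := by
  choose! g hg using fun (v : MinimalClass) (hv : v ∈ C.supp) => h.below_of_mem_supp hC hv
  refine Set.Finite.of_finite_image (f := g)
    (Set.Finite.subset B.powerset.finite_toSet ?_) ?_
  · rintro _ ⟨v, hv, rfl⟩
    exact Finset.mem_coe.2 (Finset.mem_powerset.2 (hg v hv).2.1)
  · intro v hv w hw hvw
    obtain ⟨h1, h2⟩ := (hg v hv).1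
    obtain ⟨h3, h4⟩ := (hg w hw).1
    rw [← h2, ← h4]
    congr 1

theorem card_gt (h : IsDeadBoxWithLongLines B d) : d < B.card := by
  obtain ⟨B₀, h1, -, h3⟩ := h.exists_isMinimal
  have := Finset.card_pos.2 h1.1
  omega

theorem iterate_removePoint_mem (h : IsDeadBoxWithLongLines B d) (hC : B ∈ setsInComponent C)
    {j : ℕ} (hj : j ≤ d) : removePoint^[j] B ∈ setsInComponent C := by
  have hgt := h.card_gt
  induction j with
  | zero => exact hC
  | succ j ih =>
    obtain ⟨v, hv, hrep⟩ := ih (by omega)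
    have s1 := iterate_removePoint_spec B (j := j) (by omega)
    have s2 := iterate_removePoint_spec B (j := j + 1) (by omega)
    have hmin : IsMinimal (removePoint^[j + 1] B) := h.isMinimal_of_subset (by omega) s2.2
    refine ⟨minimalClass _ hmin, ?_, represents_minimalClass hmin⟩
    have hadj : minimalSetGraph.Adj v (minimalClass _ hmin) := by
      refine ⟨_, _, hrep, represents_minimalClass hmin, ?_⟩
      rw [Function.iterate_succ_apply']
      obtain ⟨a, ha, he, -⟩ := exists_removePoint_eq (A := removePoint^[j] B)
        (Finset.card_pos.1 (by omega))
      rw [he, symmDiff_of_ge (Finset.erase_subset _ _), Finset.sdiff_erase_self ha,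
        Finset.card_singleton]
    rw [SimpleGraph.ConnectedComponent.mem_supp_iff] at hv ⊢
    rw [← hv]
    exact SimpleGraph.ConnectedComponent.sound hadj.reachable.symm

theorem componentHeight_eq (h : IsDeadBoxWithLongLines B d) (hC : B ∈ setsInComponent C) :
    componentHeight C = (d : ℕ∞) + 1 := by
  have hgt := h.card_gt
  refine le_antisymm (iSup_le ?_) ?_
  · rintro ⟨t, hsub, hchain⟩
    -- Members of a chain have distinct sizes, and only d + 1 sizes are available.
    have hinj : Set.InjOn Finset.card t := by
      intro X hX Y hY hXY
      by_contra hne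
      rcases hchain hX hY hne with hlt | hlt
      · exact (Finset.card_lt_card hlt).ne hXY
      · exact (Finset.card_lt_card hlt).ne hXY.symm
    have hmaps : Set.MapsTo Finset.card t (Finset.Icc (B.card - d) B.card : Finset ℕ) := by
      intro X hX
      have := h.of_mem_setsInComponent hC (hsub hX)
      rw [Finset.mem_coe, Finset.mem_Icc]
      omega
    have := Set.encard_le_encard_of_injOn hmaps hinj
    rw [Set.encard_coe_eq_coe_finsetCard, Nat.card_Icc] at this
    refine this.trans ?_
    rw [show B.card + 1 - (B.card - d) = d + 1 by omega]
    norm_cast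
  · have hinj : Set.InjOn (fun j => removePoint^[j] B) (Finset.range (d + 1) : Finset ℕ) := by
      intro i hi j hj hij
      rw [Finset.mem_coe, Finset.mem_range] at hi hj
      have h1 := (iterate_removePoint_spec B (j := i) (by omega)).1
      have h2 := (iterate_removePoint_spec B (j := j) (by omega)).1
      simp only at hij
      rw [hij] at h1
      omega
    have henc := hinj.encard_image
    rw [Set.encard_coe_eq_coe_finsetCard, Finset.card_range] at henc
    rw [← Nat.cast_one, ← Nat.cast_add, ← henc]
    refine Set.encard_le_chainHeight_of_isChain _ _ ?_ ?_
    · rintro _ ⟨j, hj, rfl⟩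
      rw [Finset.mem_coe, Finset.mem_range] at hj
      exact h.iterate_removePoint_mem hC (by omega)
    · rintro _ ⟨i, hi, rfl⟩ _ ⟨j, hj, rfl⟩ hne
      rcases le_total i j with hij | hij
      · exact Or.inr ((iterate_removePoint_antitone B hij).lt_of_ne hne.symm)
      · exact Or.inl ((iterate_removePoint_antitone B hij).lt_of_ne hne)

end IsDeadBoxWithLongLines

theorem card_filter_of_ncard {B : Finset (ℤ × ℤ)} {n : ℕ} {L : Set (ℤ × ℤ)} {f : ℤ × ℤ → ℤ}
    {w : ℤ} (hL : L = {p | f p = w}) (hw : ∃ p ∈ B, f p = w)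
    (h : (B : Set (ℤ × ℤ)) ∩ L = ∅ ∨ n + 2 ≤ ((B : Set (ℤ × ℤ)) ∩ L).ncard) :
    n + 1 < (B.filter fun q => f q = w).card := by
  have he : (B : Set (ℤ × ℤ)) ∩ L = (B.filter fun q => f q = w : Finset (ℤ × ℤ)) := by
    ext q
    simp [hL]
  rw [he, Set.ncard_coe_finset] at h
  obtain ⟨p, hp, hpw⟩ := hw
  rcases h with h | h
  · rw [Finset.coe_eq_empty] at h
    have : p ∈ B.filter fun q => f q = w := Finset.mem_filter.2 ⟨hp, hpw⟩
    rw [h] at this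
    exact absurd this (Finset.notMem_empty p)
  · omega

theorem isDeadBoxWithLongLines_of_hasModulus {B : Finset (ℤ × ℤ)} {d : ℕ} {α β : ℤ}
    (hB : IsBox B) (hexc : excess B = (d : ℤ)) (hmod : HasModulus B s(α, β)) (hα : 2 ≤ α)
    (hβ : 2 ≤ β)
    (hlines : ∀ L : Set (ℤ × ℤ), IsStandardLine L →
      (B : Set (ℤ × ℤ)) ∩ L = ∅ ∨ d + 2 ≤ ((B : Set (ℤ × ℤ)) ∩ L).ncard)
    (hdead : IsDead B) : IsDeadBoxWithLongLines B d := by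
  obtain ⟨-, a, b, c, e, hreg, -, hm⟩ := hmod
  have hmod' : 2 ≤ b - a ∧ 2 ≤ e - c := by
    rcases Sym2.eq_iff.1 hm with ⟨h1, h2⟩ | ⟨h1, h2⟩ <;> omega
  refine ⟨hB, hdead, hexc, fun p hp => ?_, fun p hp => ?_, ?_⟩
  · exact card_filter_of_ncard rfl ⟨p, hp, rfl⟩ (hlines _ ⟨diagU p, Or.inl rfl⟩)
  · exact card_filter_of_ncard rfl ⟨p, hp, rfl⟩ (hlines _ ⟨diagV p, Or.inr rfl⟩)
  · obtain ⟨hU, hV⟩ := image_diag_box hreg (by omega) (by omega)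
    have := boundarySize_box_le hreg (by omega) (by omega)
    rw [hU, hV, Int.card_Icc, Int.card_Icc]
    omega

/-! ### Boxes with prescribed excess -/

/-- The box with `0 ≤ y - x < 2 * m` and `0 ≤ y + x < k`. -/
def evenBox (m k : ℕ) : Finset (ℤ × ℤ) :=
  (Finset.range m ×ˢ Finset.range k).image fun i : ℕ × ℕ =>
    (((i.2 : ℤ) - (2 * i.1 + i.2 % 2)) / 2, ((i.2 : ℤ) + (2 * i.1 + i.2 % 2)) / 2)

theorem mem_evenBox {m k : ℕ} {p : ℤ × ℤ} : p ∈ evenBox m k ↔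
    (0 ≤ diagU p ∧ diagU p ≤ 2 * m - 1) ∧ (0 ≤ diagV p ∧ diagV p ≤ (k : ℤ) - 1) := by
  simp only [evenBox, Finset.mem_image, Finset.mem_product, Finset.mem_range, Prod.exists]
  constructor
  · rintro ⟨i, j, ⟨hi, hj⟩, rfl⟩
    simp only [diagU, diagV]
    omega
  · simp only [diagU, diagV]
    intro h
    refine ⟨((p.2 - p.1) / 2).toNat, (p.2 + p.1).toNat, by omega, Prod.ext ?_ ?_⟩ <;>
    · simp only
      omega

theorem coe_evenBox (m k : ℕ) :
    (evenBox m k : Set (ℤ × ℤ)) = boxRegion 0 (2 * m - 1) 0 ((k : ℤ) - 1) :=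
  Set.ext fun _ => mem_evenBox

theorem card_evenBox (m k : ℕ) : (evenBox m k).card = m * k := by
  rw [evenBox, Finset.card_image_of_injective, Finset.card_product, Finset.card_range,
    Finset.card_range]
  rintro ⟨i, j⟩ ⟨i', j'⟩ h
  simp only [Prod.mk.injEq] at h ⊢
  omega

theorem boundarySize_evenBox_le {m k : ℕ} (hm : 0 < m) (hk : 0 < k) :
    boundarySize (evenBox m k) ≤ 2 * m + k + 2 := by
  have := boundarySize_box_le (coe_evenBox m k) (by omega) (by omega)
  omega

theorem card_evenBox_lineU {m n : ℕ} {p : ℤ × ℤ} (hp : p ∈ evenBox m (2 * n)) :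
    n ≤ ((evenBox m (2 * n)).filter fun q => diagU q = diagU p).card := by
  rw [mem_evenBox] at hp
  have h := Finset.card_le_card_of_injOn (s := Finset.range n)
    (t := (evenBox m (2 * n)).filter fun q => diagU q = diagU p)
    (fun j => (((2 * j + diagU p % 2) - diagU p) / 2, ((2 * j + diagU p % 2) + diagU p) / 2)) ?_ ?_
  · rwa [Finset.card_range] at h
  · intro j hj
    rw [Finset.mem_coe, Finset.mem_range] at hj
    rw [Finset.mem_coe, Finset.mem_filter, mem_evenBox]
    generalize diagU p = u at *
    simp only [diagU, diagV]
    push_cast at hp ⊢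
    omega
  · intro i _ j _ h
    simp only [Prod.mk.injEq] at h
    omega

theorem card_evenBox_lineV {m k : ℕ} {p : ℤ × ℤ} (hp : p ∈ evenBox m k) :
    m ≤ ((evenBox m k).filter fun q => diagV q = diagV p).card := by
  rw [mem_evenBox] at hp
  have h := Finset.card_le_card_of_injOn (s := Finset.range m)
    (t := (evenBox m k).filter fun q => diagV q = diagV p)
    (fun j => ((diagV p - (2 * j + diagV p % 2)) / 2, (diagV p + (2 * j + diagV p % 2)) / 2)) ?_ ?_
  · rwa [Finset.card_range] at h
  · intro j hj
    rw [Finset.mem_coe, Finset.mem_range] at hj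
    rw [Finset.mem_coe, Finset.mem_filter, mem_evenBox]
    generalize diagV p = v at *
    simp only [diagU, diagV]
    omega
  · intro i _ j _ h
    simp only [Prod.mk.injEq] at h
    omega

theorem isDead_of_forall {A : Finset (ℤ × ℤ)} (hA : IsMinimal A)
    (h : ∀ A' : Finset (ℤ × ℤ), A ⊆ A' → A'.card = A.card + 1 → ¬ IsMinimal A') : IsDead A := by
  refine ⟨hA, le_antisymm (iSup₂_le ?_) bot_le⟩
  rintro n ⟨s, h0, hmono, hs⟩
  rcases n with _ | n
  · simp
  · have h1 := hs 1
    refine absurd h1.1 (h _ ?_ ?_)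
    · rw [← h0]
      exact hmono (Fin.zero_le 1)
    · simpa using h1.2

/-- If `m * k + 1` is the smallest size forcing a boundary of size `2 * a + 2 * b + 2` and the
box with projections of sizes `2 * a` and `2 * b` is not the largest one with its boundary size,
then that box is dead. -/
theorem isDeadBoxWithLongLines_evenBox {a b d m k m' n' : ℕ} (ha : d + 2 ≤ a) (hb : d + 2 ≤ b)
    (hm : 0 < m) (hk : 0 < k) (hsum : 2 * m + k + 1 = 2 * a + 2 * b)
    (hcard : m * k + d + 1 = a * (2 * b))
    (hiso : (2 * (a : ℤ) + 2 * b - 1) ^ 2 + 4 < 8 * ((m * k : ℕ) + 1))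
    (hm' : 0 < m') (hn' : 0 < n') (hsum' : m' + n' = a + b) (hlt : a * (2 * b) < m' * (2 * n')) :
    IsDeadBoxWithLongLines (evenBox a (2 * b)) d := by
  -- By `hiso` more than mk points force boundary at least 2a + 2b + 2, while `evenBox m k` has
  -- boundary at most 2a + 2b + 1. So mk + 1 is the least size of a minimal set with the boundary
  -- size of the given box.
  have hlarge : ∀ A : Finset (ℤ × ℤ), m * k < A.card → 2 * a + 2 * b + 2 ≤ boundarySize A := by
    intro A hA
    obtain ⟨h2, h8⟩ := isoperimetric A (Finset.card_pos.1 (by omega))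
    by_contra hcon
    have hle : (boundarySize A : ℤ) - 2 ≤ 2 * (a : ℤ) + 2 * b - 1 := by omega
    have hsq := pow_le_pow_left₀ (by omega) hle 2
    have : ((m * k : ℕ) : ℤ) + 1 ≤ A.card := by exact_mod_cast hA
    linarith
  have hBcard := card_evenBox a (2 * b)
  have hBle := boundarySize_evenBox_le (m := a) (k := 2 * b) (by omega) (by omega)
  have hBge := hlarge (evenBox a (2 * b)) (by omega)
  have hmin : ∀ A : Finset (ℤ × ℤ), m * k < A.card → boundarySize A ≤ 2 * a + 2 * b + 2 →
      IsMinimal A := by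
    refine fun A hA hle => ⟨Finset.card_pos.1 (by omega), fun C hC => hle.trans (hlarge C ?_)⟩
    omega
  have hBmin := hmin (evenBox a (2 * b)) (by omega) hBle
  obtain ⟨hU, hV⟩ := image_diag_box (coe_evenBox a (2 * b)) (by omega) (by push_cast; omega)
  have hUV : (((evenBox a (2 * b)).image diagU).card : ℤ) = 2 * a ∧
      (((evenBox a (2 * b)).image diagV).card : ℤ) = 2 * b := by
    rw [hU, hV, Int.card_Icc, Int.card_Icc]
    push_cast
    omega
  refine ⟨⟨hBmin.1, _, _, _, _, coe_evenBox a (2 * b)⟩, isDead_of_forall hBmin ?_, ?_,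
    fun p hp => ?_, fun p hp => ?_, ?_⟩
  · intro A' hsub hcard' hmin'
    -- The larger box with the same boundary bound keeps the boundary of a minimal `A'` at 2a + 2b +
    -- 2. Its projections then cannot grow, so `A'` stays inside the box, which is too small for it.
    have hle := hmin'.boundarySize_le (B := evenBox m' (2 * n'))
      (by rw [card_evenBox]; omega)
    have hle' := boundarySize_evenBox_le (m := m') (k := 2 * n') hm' (by omega)
    have hlow := card_image_add_card_image_le_boundarySize A' hmin'.1
    have hU' := Finset.image_subset_image (f := diagU) hsub
    have hV' := Finset.image_subset_image (f := diagV) hsub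
    have hUc := Finset.card_le_card hU'
    have hVc := Finset.card_le_card hV'
    have hUe := Finset.eq_of_subset_of_card_le hU' (by omega)
    have hVe := Finset.eq_of_subset_of_card_le hV' (by omega)
    have hsub' : A' ⊆ evenBox a (2 * b) := by
      intro p hp
      have h1 : diagU p ∈ (evenBox a (2 * b)).image diagU := by
        rw [hUe]
        exact Finset.mem_image_of_mem _ hp
      have h2 : diagV p ∈ (evenBox a (2 * b)).image diagV := by
        rw [hVe]
        exact Finset.mem_image_of_mem _ hp
      rw [hU, Finset.mem_Icc] at h1
      rw [hV, Finset.mem_Icc] at h2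
      exact mem_evenBox.2 ⟨h1, h2⟩
    have := Finset.card_le_card hsub'
    omega
  · refine hBmin.excess_isGreatest.unique ⟨?_, ?_⟩
    · obtain ⟨A, -, hAc, hAle⟩ := exists_subset_card_boundarySize_le (evenBox a (2 * b))
        (k := m * k + 1) (by omega)
      refine ⟨A, hmin A (by omega) (hAle.trans hBle), ?_, by omega⟩
      have := hlarge A (by omega)
      omega
    · rintro _ ⟨A, hA, hbd, rfl⟩
      have : m * k < A.card := by
        by_contra hcon
        have h1 := hA.boundarySize_le (B := evenBox m k) (by rw [card_evenBox]; omega)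
        have h2 := boundarySize_evenBox_le hm hk
        omega
      omega
  · have := card_evenBox_lineU hp
    omega
  · have := card_evenBox_lineV hp
    omega
  · omega

/-- Here a and b differ by 3 and s = 2n + 11, so the excess (s - 9)/2 - 1 equals n; halves differing
by 1 give the larger box. -/
theorem isDeadBoxWithLongLines_evenBox_tall (n : ℕ) :
    IsDeadBoxWithLongLines (evenBox (n + 4) (2 * (n + 7))) n := by
  refine isDeadBoxWithLongLines_evenBox (m := n + 5) (k := 2 * n + 11) (m' := n + 5)
    (n' := n + 6) (by omega) (by omega) (by omega) (by omega) (by omega) (by ring) ?_ (by omega)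
    (by omega) (by omega) (by nlinarith)
  push_cast
  nlinarith

/-- Here (b - a)² = (2t + 2)² = s - 2, exactly the elongation that makes the excess vanish; the
larger box has both halves equal to s/2. -/
theorem isDeadBoxWithLongLines_evenBox_zero (t : ℕ) : IsDeadBoxWithLongLines
    (evenBox (2 * t ^ 2 + 3 * t + 2) (2 * (2 * t ^ 2 + 5 * t + 4))) 0 := by
  refine isDeadBoxWithLongLines_evenBox (m := 2 * t ^ 2 + 4 * t + 3) (k := 4 * t ^ 2 + 8 * t + 5)
    (m' := 2 * t ^ 2 + 4 * t + 3) (n' := 2 * t ^ 2 + 4 * t + 3) (by omega) (by omega) (by omega)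
    (by omega) (by omega) (by ring) ?_ (by omega) (by omega) (by omega) (by nlinarith)
  push_cast
  nlinarith

theorem mem_setsInComponent_minimalClass {A : Finset (ℤ × ℤ)} (hA : IsMinimal A) :
    A ∈ setsInComponent (minimalSetGraph.connectedComponentMk (minimalClass A hA)) :=
  ⟨_, rfl, represents_minimalClass hA⟩

/-- For d = 0 a neighbour would have a representative inside `B` missing no point, hence be the
class of `B` itself. -/
theorem IsDeadBoxWithLongLines.isIsolated {B : Finset (ℤ × ℤ)}
    (h : IsDeadBoxWithLongLines B 0) :
    minimalSetGraph.IsIsolated (minimalClass B h.isDead.1) := by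
  intro w hw
  obtain ⟨A, hA, hAB, hcard⟩ := h.below_of_adj
    ⟨B, represents_minimalClass h.isDead.1, subset_rfl, by omega⟩ hw
  have := Finset.eq_of_subset_of_card_le hAB (by omega)
  subst this
  obtain ⟨hA, hAw⟩ := hA
  subst hAw
  exact hw.ne rfl

theorem mainTheorem9 :
    -- the criterion for finite components
    (∀ (B : Finset (ℤ × ℤ)) (d : ℕ) (α β : ℤ), IsBox B →
      excess B = (d : ℤ) →
      HasModulus B s(α, β) → 2 ≤ α → 2 ≤ β →
      (∀ L : Set (ℤ × ℤ), IsStandardLine L →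
        (B : Set (ℤ × ℤ)) ∩ L = ∅ ∨ d + 2 ≤ ((B : Set (ℤ × ℤ)) ∩ L).ncard) →
      IsDead B →
      ∀ C : minimalSetGraph.ConnectedComponent, B ∈ setsInComponent C →
        (∀ A ∈ setsInComponent C,
          (B.card : ℤ) - (d : ℤ) ≤ (A.card : ℤ) ∧ A.card ≤ B.card ∧
          ∃ E : Finset (ℤ × ℤ), IsEnclosingBox A E ∧ LatticeCongruent E B) ∧
        (∀ k : ℕ, (B.card : ℤ) - (d : ℤ) ≤ (k : ℤ) → k ≤ B.card →
          ∃ A ∈ setsInComponent C, A.card = k) ∧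
        C.supp.Finite ∧
        componentHeight C = (d : ℕ∞) + 1) ∧
    -- finite components of arbitrarily large height
    (∀ n : ℕ, ∃ C : minimalSetGraph.ConnectedComponent, C.supp.Finite ∧
      ∃ h : ℕ, componentHeight C = (h : ℕ∞) ∧ n ≤ h) ∧
    -- infinitely many isolated vertices
    {v : MinimalClass | minimalSetGraph.IsIsolated v}.Infinite := by
  refine ⟨?_, ?_, ?_⟩
  · intro B d α β hbox hexc hmod hα hβ hlines hdead C hC
    have h := isDeadBoxWithLongLines_of_hasModulus hbox hexc hmod hα hβ hlines hdead
    refine ⟨fun A hA => ?_, fun k hk hkB => ?_, h.finite_supp hC, h.componentHeight_eq hC⟩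
    · obtain ⟨h1, h2, h3⟩ := h.of_mem_setsInComponent hC hA
      exact ⟨by omega, h2, h3⟩
    · refine ⟨_, h.iterate_removePoint_mem hC (j := B.card - k) (by omega), ?_⟩
      have := (iterate_removePoint_spec B (j := B.card - k) (by omega)).1
      omega
  · intro n
    have h := isDeadBoxWithLongLines_evenBox_tall n
    have hC := mem_setsInComponent_minimalClass h.isDead.1
    exact ⟨_, h.finite_supp hC, n + 1, by rw [h.componentHeight_eq hC]; norm_cast, by omega⟩
  · refine Set.infinite_of_injective_forall_mem
      (f := fun t : ℕ => minimalClass _ (isDeadBoxWithLongLines_evenBox_zero t).isDead.1) ?_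
      fun t => (isDeadBoxWithLongLines_evenBox_zero t).isIsolated
    intro s t hst
    have hc := LatticeCongruent.card_eq (Quotient.exact hst)
    simp only [card_evenBox] at hc
    have hmono : StrictMono fun t : ℕ =>
        (2 * t ^ 2 + 3 * t + 2) * (2 * (2 * t ^ 2 + 5 * t + 4)) := by
      intro i j hij
      have h1 : i ^ 2 < j ^ 2 := Nat.pow_lt_pow_left hij two_ne_zero
      exact Nat.mul_lt_mul'' (by omega) (by omega)
    exact hmono.injective hc
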